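/- **Setting.** Let $\theta=(\gamma',\beta',\delta')'\in\Theta=\Theta_\gamma\times\Theta_\beta\times\Theta_\delta\subset\mathbb R^{d_\gamma+d_\beta+d_\delta}$, where $\Theta_\gamma=[\gamma_L,\gamma_U]^s\times[0,\gamma_U]^{d_\gamma-s}$ with $0\le s\le d_\gamma$, $\Theta_\beta=[0,\beta_U]^{d_\beta}$, $-\infty\le\gamma_L<0<\gamma_U\le\infty$, $0<\beta_U\le\infty$ (an infinite end point meaning that there is no bound; parameters are finite), and $\Theta_\delta\subset\mathbb R^{d_\delta}$ is compact. Let $\Phi$ be a compact metric space, $\Phi(\theta)\subset\Phi$, and $\Psi=\{\psi=(\theta,\phi):\theta\in\Theta,\ \phi\in\Phi(\theta)\}$; $\psi$ determines the law $\mathbb P_\psi$ of the data $W_1,W_2,\dots$. Let $L_n(\theta)=f_n(W_1,\dots,W_n;\theta)$ be a real-valued objective function. Fix $\gamma_0$, put $\Theta_{\mathsf H_0}=\{\theta\in\Theta:\gamma=\gamma_0\}$, let $\hat\theta_n$ and $\tilde\theta_n$ be maximizers of $L_n$ over $\Theta$ and over $\Theta_{\mathsf H_0}$ respectively, and let $\mathsf{LR}_n=2(L_n(\hat\theta_n)-L_n(\tilde\theta_n))$.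 Let $\psi_n=(\theta_n,\phi_n)\in\Psi$, with $\theta_n=(\gamma_0',\beta_n',\delta_n')'\in\Theta_{\mathsf H_0}$, be a sequence such that $\psi_n\to\psi_0=(\theta_0,\phi_0)$, $\theta_0=(\gamma_0',\beta_0',\delta_0')'$, and $\sqrt n\,\beta_n\to b\in[0,\infty]^{d_\beta}$ componentwise, where $\delta_0$ is an interior point of $\Theta_\delta$ and $\beta_{0,i}<\beta_U$ for all $i$. Let $\Upsilon$ be the set of symmetric positive definite matrices with all eigenvalues in $[\kappa,\kappa^{-1}]$, where $\kappa>0$ is fixed. Suppose that, under $\mathbb P_{\psi_n}$ as $n\to\infty$: 1. $\hat\theta_n-\theta_n=o_p(1)$ and $\tilde\theta_n-\theta_n=o_p(1)$. 2. (i) For all $n\ge1$, almost surely, $L_n$ has continuous partial derivatives up to order two on the set of $\theta\in\Theta$ whose component $\delta$ is an interior point of $\Theta_\delta$, where the derivative in a coordinate that can be perturbed within $\Theta$ to one side only is the corresponding left or right derivative. (ii) For all deterministic $\epsilon_n\to0$, $$\sup_{\theta\in\Theta:\|\theta-\theta_n\|\le\epsilon_n}\left\|n^{-1}\frac{\partial^2L_n(\theta)}{\partial\theta\partial\theta'}-n^{-1}\frac{\partial^2L_n(\theta_n)}{\partial\theta\partial\theta'}\right\|=o_p(1).$$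 3. $n^{-1}\,\partial^2L_n(\theta_n)/\partial\theta\partial\theta'\overset{p}{\to}-\Omega_0$ with $\Omega_0\in\Upsilon$. 4. $n^{-1/2}\,\partial L_n(\theta_n)/\partial\theta\overset{d}{\to}N(0,\Sigma_0)$ with $\Sigma_0\in\Upsilon$. **Statement.** Then $$\mathsf{LR}_n\overset{d}{\to}\mathcal L_\infty(b,b)\quad\text{under }\mathbb P_{\psi_n},\qquad \mathcal L_\infty(x,y)=\inf_{\lambda\in\{0\}^{d_\gamma}\times\Lambda_\beta(x)}Q(\lambda)-\inf_{\lambda\in\Lambda_\gamma\times\Lambda_\beta(y)}Q(\lambda),\quad x,y\in[0,\infty]^{d_\beta}.$$ Here $Q(\lambda)=(\lambda-HZ)'(H\Omega_0^{-1}H')^{-1}(\lambda-HZ)$ for $\lambda\in\mathbb R^{d_\gamma+d_\beta}$, $H$ is the selection matrix with $H\theta=(\gamma',\beta')'$, $Z\sim N(0,\Omega_0^{-1}\Sigma_0\Omega_0^{-1})$, $\Lambda_\beta(x)=\prod_{i=1}^{d_\beta}\{t\in\mathbb R:t\ge-x_i\}$, and $\Lambda_\gamma=\lim_{n\to\infty}\sqrt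 n(\Theta_\gamma-\gamma_0)$ in the sense of Painlevé–Kuratowski. This limit exists and equals $\Lambda_{\gamma,1}\times\cdots\times\Lambda_{\gamma,d_\gamma}$, where $\Lambda_{\gamma,i}=\mathbb R$ if $\gamma_{0,i}$ is an interior point of the $i$-th factor of $\Theta_\gamma$, $\Lambda_{\gamma,i}=[0,\infty)$ if $\gamma_{0,i}$ is the lower end point of that factor, and $\Lambda_{\gamma,i}=(-\infty,0]$ if it is the upper end point. -/

import Mathlib

open Filter Topology MeasureTheory ProbabilityTheory
open scoped ENNReal Matrix Matrix.Norms.L2Operator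

noncomputable section

/-! ### Parameters `θ = (γ', β', δ')'` -/

/-- Coordinates of `θ = (γ', β', δ')'`. -/
abbrev Idx (dγ dβ dδ : ℕ) : Type := (Fin dγ ⊕ Fin dβ) ⊕ Fin dδ

/-- The Euclidean space containing `θ = (γ', β', δ')'`. -/
abbrev Par (dγ dβ dδ : ℕ) : Type := EuclideanSpace ℝ (Idx dγ dβ dδ)

variable {dγ dβ dδ : ℕ}

/-- The `γ`-part of `θ`. -/
def gam (θ : Par dγ dβ dδ) : Fin dγ → ℝ := fun i => θ (.inl (.inl i))

/-- The `β`-part of `θ`. -/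
def bet (θ : Par dγ dβ dδ) : Fin dβ → ℝ := fun i => θ (.inl (.inr i))

/-- The `δ`-part of `θ`. -/
def del (θ : Par dγ dβ dδ) : Fin dδ → ℝ := fun i => θ (.inr i)

/-- Lower end point of the range of `γ_i`: it is `γ_L` for the first `s` components and `0` for
the others. -/
def gammaLower (s : ℕ) (γL : EReal) (i : Fin dγ) : EReal := if (i : ℕ) < s then γL else 0

/-- `Θ_γ = [γ_L, γ_U]^s × [0, γ_U]^(d_γ - s)` (finite points only). -/
def ThetaGamma (dγ s : ℕ) (γL γU : EReal) : Set (Fin dγ → ℝ) :=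
  {g | ∀ i, gammaLower s γL i ≤ (g i : EReal) ∧ (g i : EReal) ≤ γU}

/-- `Θ_β = [0, β_U]^d_β` (finite points only). -/
def ThetaBeta (dβ : ℕ) (βU : EReal) : Set (Fin dβ → ℝ) :=
  {c | ∀ i, 0 ≤ c i ∧ (c i : EReal) ≤ βU}

/-- `Θ = Θ_γ × Θ_β × Θ_δ`. -/
def Theta (s : ℕ) (γL γU βU : EReal) (Θδ : Set (Fin dδ → ℝ)) : Set (Par dγ dβ dδ) :=
  {θ | gam θ ∈ ThetaGamma dγ s γL γU ∧ bet θ ∈ ThetaBeta dβ βU ∧ del θ ∈ Θδ}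

/-- The points of `Θ` that satisfy the null hypothesis `γ = γ₀`. -/
def ThetaNull (Θ : Set (Par dγ dβ dδ)) (γ₀ : Fin dγ → ℝ) : Set (Par dγ dβ dδ) :=
  {θ ∈ Θ | gam θ = γ₀}

/-- The space `Ψ` of all `ψ = (θ, φ)` with `θ ∈ Θ` and `φ ∈ Φ(θ)`. -/
def Psi {Φ : Type*} (Θ : Set (Par dγ dβ dδ)) (Φset : Par dγ dβ dδ → Set Φ) :
    Set (Par dγ dβ dδ × Φ) :=
  {ψ | ψ.1 ∈ Θ ∧ ψ.2 ∈ Φset ψ.1}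

/-! ### Left/right partial derivatives on `Θ`

At `θ ∈ Θ` the derivative in the `i`-th coordinate is taken within `Θ`: it is the ordinary partial
derivative where `θ_i` can be perturbed to both sides, and the left (right) partial derivative where
`θ_i` can be perturbed to the left (right) only. -/

/-- The `i`-th coordinate direction. -/
def dir (i : Idx dγ dβ dδ) : Par dγ dβ dδ := EuclideanSpace.single i 1

/-- Left/right partial derivative `∂F/∂θ_i` at `θ`, within `Θ`. -/
def pderiv (Θ : Set (Par dγ dβ dδ)) (F : Par dγ dβ dδ → ℝ) (i : Idx dγ dβ dδ)
    (θ : Par dγ dβ dδ) : ℝ :=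
  lineDerivWithin ℝ F Θ θ (dir i)

/-- The vector `∂F(θ)/∂θ`. -/
def score (Θ : Set (Par dγ dβ dδ)) (F : Par dγ dβ dδ → ℝ) (θ : Par dγ dβ dδ) : Par dγ dβ dδ :=
  WithLp.toLp 2 fun i => pderiv Θ F i θ

/-- The matrix `∂²F(θ)/∂θ∂θ'`. -/
def hessian (Θ : Set (Par dγ dβ dδ)) (F : Par dγ dβ dδ → ℝ) (θ : Par dγ dβ dδ) :
    Matrix (Idx dγ dβ dδ) (Idx dγ dβ dδ) ℝ :=
  Matrix.of fun i j => pderiv Θ (pderiv Θ F j) i θ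

/-- `F` has left/right partial derivatives (within `Θ`) up to order two at all points of `T ⊆ Θ`,
and `F` and these derivatives are continuous on `T`. -/
def HasContLRDeriv2 (Θ T : Set (Par dγ dβ dδ)) (F : Par dγ dβ dδ → ℝ) : Prop :=
  (∀ θ ∈ T, ∀ i, LineDifferentiableWithinAt ℝ F Θ θ (dir i)) ∧
  (∀ θ ∈ T, ∀ i j, LineDifferentiableWithinAt ℝ (pderiv Θ F j) Θ θ (dir i)) ∧
  ContinuousOn F T ∧ ContinuousOn (score Θ F) T ∧
  ∀ i j, ContinuousOn (fun θ => hessian Θ F θ i j) T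

/-! ### Stochastic order symbol and the set of matrices `Υ` -/

/-- `X_n = o_p(1)` for `[0, ∞]`-valued `X_n`, where `X_n` is considered under `P_n`. -/
def IsLittleOpOne {Ω : Type*} [MeasurableSpace Ω] (P : ℕ → Measure Ω) (X : ℕ → Ω → ℝ≥0∞) : Prop :=
  ∀ ε : ℝ≥0∞, 0 < ε → Tendsto (fun n => P n {ω | ε ≤ X n ω}) atTop (𝓝 0)

/-- Positive definite matrices with all eigenvalues in `[κ, 1/κ]`. -/
def Upsilon {ι : Type*} [Fintype ι] [DecidableEq ι] (κ : ℝ) : Set (Matrix ι ι ℝ) :=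
  {A | A.PosDef ∧ spectrum ℝ A ⊆ Set.Icc κ κ⁻¹}

/-! ### The four high-level conditions, along a sequence of true values `θ_n` and laws `P_n` -/

section conditions

variable {Ω : Type*} [MeasurableSpace Ω]

/-- Consistency of the unrestricted and of the restricted estimator. -/
def Consistency (P : ℕ → Measure Ω) (θhat θtilde : ℕ → Ω → Par dγ dβ dδ)
    (θn : ℕ → Par dγ dβ dδ) : Prop :=
  IsLittleOpOne P (fun n ω => ‖θhat n ω - θn n‖ₑ) ∧
  IsLittleOpOne P (fun n ω => ‖θtilde n ω - θn n‖ₑ)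

/-- Smoothness of the objective function: (i) continuous left/right partial derivatives of order
two on `T`, almost surely, for all `n ≥ 1`; (ii) for every deterministic `ε_n → 0` the supremum over
`θ ∈ Θ`, `‖θ - θ_n‖ ≤ ε_n`, of the norm of the difference of the normalized Hessians at `θ` and at
`θ_n` is `o_p(1)`. -/
def Smoothness (P : ℕ → Measure Ω) (L : ℕ → Ω → Par dγ dβ dδ → ℝ) (Θ T : Set (Par dγ dβ dδ))
    (θn : ℕ → Par dγ dβ dδ) : Prop :=
  (∀ n, 1 ≤ n → ∀ᵐ ω ∂(P n), HasContLRDeriv2 Θ T (L n ω)) ∧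
  ∀ ε : ℕ → ℝ, Tendsto ε atTop (𝓝 0) →
    IsLittleOpOne P (fun (n : ℕ) ω => ⨆ θ ∈ {θ ∈ Θ | ‖θ - θn n‖ ≤ ε n},
      ‖(n : ℝ)⁻¹ • hessian Θ (L n ω) θ - (n : ℝ)⁻¹ • hessian Θ (L n ω) (θn n)‖ₑ)

/-- The normalized Hessian at `θ_n` converges in probability to `-Ω₀`. -/
def HessianLimit (P : ℕ → Measure Ω) (L : ℕ → Ω → Par dγ dβ dδ → ℝ) (Θ : Set (Par dγ dβ dδ))
    (θn : ℕ → Par dγ dβ dδ) (Ω₀ : Matrix (Idx dγ dβ dδ) (Idx dγ dβ dδ) ℝ) : Prop :=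
  IsLittleOpOne P (fun (n : ℕ) ω => ‖(n : ℝ)⁻¹ • hessian Θ (L n ω) (θn n) - (-Ω₀)‖ₑ)

/-- The normalized score at `θ_n` converges in distribution to `N(0, Σ₀)`. -/
def ScoreLimit (P : ℕ → Measure Ω) [∀ n, IsProbabilityMeasure (P n)]
    (L : ℕ → Ω → Par dγ dβ dδ → ℝ) (Θ : Set (Par dγ dβ dδ))
    (θn : ℕ → Par dγ dβ dδ) (S₀ : Matrix (Idx dγ dβ dδ) (Idx dγ dβ dδ) ℝ) : Prop :=
  TendstoInDistribution (fun (n : ℕ) ω => (√(n : ℝ))⁻¹ • score Θ (L n ω) (θn n)) atTop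
    (id : Par dγ dβ dδ → Par dγ dβ dδ) P (multivariateGaussian 0 S₀)

end conditions

/-! ### The limit -/

/-- Painlevé–Kuratowski convergence of a sequence of sets: `B` is both the set of all limits of
sequences `a_n ∈ A_n` and the set of all cluster points of such sequences. -/
def SetConverges {X : Type*} [TopologicalSpace X] (A : ℕ → Set X) (B : Set X) : Prop :=
  B = {x | ∀ U ∈ 𝓝 x, ∀ᶠ n in atTop, (A n ∩ U).Nonempty} ∧
  B = {x | ∀ U ∈ 𝓝 x, ∃ᶠ n in atTop, (A n ∩ U).Nonempty}

/-- `Λ_γ = Λ_{γ,1} × ⋯ × Λ_{γ,d_γ}`, where `Λ_{γ,i}` is `[0, ∞)` if `γ_{0,i}` is the lower end point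
of its range, `(-∞, 0]` if it is the upper end point, and `ℝ` if it is an interior point. -/
def LambdaGamma (s : ℕ) (γL γU : EReal) (γ₀ : Fin dγ → ℝ) : Set (Fin dγ → ℝ) :=
  Set.univ.pi fun i => {t : ℝ | ((γ₀ i : EReal) = gammaLower s γL i → 0 ≤ t) ∧
    ((γ₀ i : EReal) = γU → t ≤ 0)}

/-- `Λ_β(x) = [-x_1, ∞] × ⋯ × [-x_{d_β}, ∞]` (finite points only). -/
def LambdaBeta (x : Fin dβ → ℝ≥0∞) : Set (Fin dβ → ℝ) :=
  {c | ∀ i, -(x i : EReal) ≤ (c i : EReal)}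

/-- The product `A × B` as a set of vectors `λ = (λ_γ', λ_β')'`. -/
def stack (A : Set (Fin dγ → ℝ)) (B : Set (Fin dβ → ℝ)) : Set (Fin dγ ⊕ Fin dβ → ℝ) :=
  {v | (fun i => v (.inl i)) ∈ A ∧ (fun i => v (.inr i)) ∈ B}

/-- The selection matrix with `H θ = (γ', β')'`. -/
def selH (dγ dβ dδ : ℕ) : Matrix (Fin dγ ⊕ Fin dβ) (Idx dγ dβ dδ) ℝ :=
  Matrix.fromCols 1 0

/-- `Q(λ) = ‖λ - H z‖²` in the norm of the matrix `(H Ω₀⁻¹ H')⁻¹`. -/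
def quadQ (Ω₀ : Matrix (Idx dγ dβ dδ) (Idx dγ dβ dδ) ℝ) (z : Par dγ dβ dδ)
    (v : Fin dγ ⊕ Fin dβ → ℝ) : ℝ :=
  (v - selH dγ dβ dδ *ᵥ z) ⬝ᵥ
    ((selH dγ dβ dδ * Ω₀⁻¹ * (selH dγ dβ dδ)ᵀ)⁻¹ *ᵥ (v - selH dγ dβ dδ *ᵥ z))

/-- `L_∞(x, y)`, as a function of the value `z` of the Gaussian vector `Z`. -/
def Linfty (Ω₀ : Matrix (Idx dγ dβ dδ) (Idx dγ dβ dδ) ℝ) (Λγ : Set (Fin dγ → ℝ))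
    (x y : Fin dβ → ℝ≥0∞) (z : Par dγ dβ dδ) : ℝ :=
  sInf (quadQ Ω₀ z '' stack {0} (LambdaBeta x)) - sInf (quadQ Ω₀ z '' stack Λγ (LambdaBeta y))

end

/-! Put `h = √n (θ - θ_n)` and let `g_n` be the normalized score at `θ_n`. By the smoothness and
Hessian conditions, `2 (L_n(θ_n + h/√n) - L_n(θ_n))` equals the quadratic gain `2⟪g_n, h⟫ - ⟪h, Ω₀
h⟫` up to an error `η ‖h‖²`, uniformly on a neighbourhood of `θ_n` of deterministic radius tending
to zero. Since only one-sided partial derivatives are available at the boundary, this expansion is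
proved on boxes (`abs_taylor_two_le_of_euclideanBox`).

Consistency places both estimators in that neighbourhood with probability tending to one. Comparison
with `h = 0` and coercivity of `Ω₀` then confine the rescaled estimators to a ball whose radius
depends only on a bound for `g_n`, and `g_n` is tight. On balls of fixed radius the rescaled
parameter space is close to `Λ_γ × Λ_β(b) × ℝ^dδ`, and its null part to `{0} × Λ_β(b) × ℝ^dδ`
(`eventually_local_approx`). A deterministic comparison of maxima (`exists_abs_sub_maxGain_le`)
therefore shows that the statistic differs by `o_p(1)` from `D(g_n)`, where `D(g)` is the difference
of the suprema of the gain over these two limit sets.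

Each supremum is a finite convex function of `g`, hence continuous, so continuous mapping and
Slutsky's theorem give the limit `D(G)` with `G ∼ N(0, Σ₀)`. Finally `G` has the law of `Ω₀ Z`.
Completing the square at `g = Ω₀ z` and minimizing over the free `δ`-part turns `D(Ω₀ z)` into the
difference of infima of `Q` (`sInf_quadQ_eq`, `Linfty_eq`). -/

noncomputable section

variable {dγ dβ dδ : ℕ}

/-! ### Second-order expansion on a box with one-sided partial derivatives -/

section Taylor

variable {ι : Type*}

/-- The product of the sets `I i`, inside Euclidean space. -/
def euclideanBox (I : ι → Set ℝ) : Set (EuclideanSpace ℝ ι) := {x | ∀ i, x i ∈ I i}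

theorem convex_euclideanBox {I : ι → Set ℝ} (hI : ∀ i, (I i).OrdConnected) :
    Convex ℝ (euclideanBox I) := by
  intro x hx y hy a b ha hb hab i
  have := (hI i).convex (hx i) (hy i) ha hb hab
  simpa using this

variable [DecidableEq ι]

/-- The mean value inequality along a coordinate direction. -/
theorem abs_sub_le_of_hasLineDerivWithinAt_single {B : Set (EuclideanSpace ℝ ι)}
    {F G : EuclideanSpace ℝ ι → ℝ} {j : ι} {p : EuclideanSpace ℝ ι} {u m ε : ℝ}
    (hB : ∀ t ∈ Set.uIcc 0 u, p + t • EuclideanSpace.single j (1 : ℝ) ∈ B)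
    (hF : ∀ x ∈ B, HasLineDerivWithinAt ℝ F (G x) B x (EuclideanSpace.single j 1))
    (hG : ∀ t ∈ Set.uIcc 0 u, |G (p + t • EuclideanSpace.single j (1 : ℝ)) - m| ≤ ε) :
    |F (p + u • EuclideanSpace.single j (1 : ℝ)) - F p - m * u| ≤ ε * |u| := by
  set e : EuclideanSpace ℝ ι := EuclideanSpace.single j (1 : ℝ) with he
  have key := (convex_uIcc (0 : ℝ) u).norm_image_sub_le_of_norm_hasDerivWithin_le
    (f := fun t => F (p + t • e) - m * t) (f' := fun t => G (p + t • e) - m) (C := ε)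
    (x := 0) (y := u) (fun t ht => ?_) (fun t ht => by simpa using hG t ht)
    Set.left_mem_uIcc Set.right_mem_uIcc
  · simp only [Real.norm_eq_abs, zero_smul, add_zero, mul_zero, sub_zero] at key
    rwa [show F (p + u • e) - F p - m * u = F (p + u • e) - m * u - F p by ring]
  · have h1 := hF _ (hB t ht)
    unfold HasLineDerivWithinAt at h1
    -- The line derivative at `p + t • e` is a derivative at parameter `0`; composing with `s ↦ s -
    -- t` moves it to parameter `t` on the line through `p`.
    have h2 : HasDerivWithinAt (fun s : ℝ => s - t) 1 (Set.uIcc 0 u) t :=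
      ((hasDerivAt_id t).sub_const t).hasDerivWithinAt
    have h3 : HasDerivWithinAt (fun s => F (p + s • e)) (G (p + t • e)) (Set.uIcc 0 u) t := by
      have h4 := HasDerivWithinAt.scomp_of_eq (x := t) (h := fun s : ℝ => s - t)
        (g₁ := fun s => F (p + t • e + s • e)) h1 h2 (fun s hs => by
          have := hB s hs
          simpa [add_assoc, ← add_smul] using this) (by simp)
      simpa [Function.comp_def, add_assoc, ← add_smul] using h4
    have h5 : HasDerivWithinAt (fun s : ℝ => m * s) (m * 1) (Set.uIcc 0 u) t :=
      ((hasDerivAt_id t).const_mul m).hasDerivWithinAt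
    simpa using h3.fun_sub h5

variable [Fintype ι]

/-- A function with continuous one-sided partial derivatives on a box is differentiable within
the box. -/
theorem hasFDerivWithinAt_euclideanBox {I : ι → Set ℝ} (hI : ∀ i, (I i).OrdConnected)
    {F : EuclideanSpace ℝ ι → ℝ} {G : ι → EuclideanSpace ℝ ι → ℝ}
    (hF : ∀ i, ∀ x ∈ euclideanBox I,
      HasLineDerivWithinAt ℝ F (G i x) (euclideanBox I) x (EuclideanSpace.single i 1))
    (hG : ∀ i, ContinuousOn (G i) (euclideanBox I)) {x : EuclideanSpace ℝ ι}
    (hx : x ∈ euclideanBox I) :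
    HasFDerivWithinAt F (∑ i, G i x • (EuclideanSpace.proj i : EuclideanSpace ℝ ι →L[ℝ] ℝ))
      (euclideanBox I) x := by
  rw [hasFDerivWithinAt_iff_isLittleO, Asymptotics.isLittleO_iff]
  intro ε hε
  -- Each coordinate receives the error share `ε / N`; the extra `1` keeps `N` positive when `ι` is
  -- empty.
  set N : ℝ := Fintype.card ι + 1
  have hN : 0 < N := by positivity
  have hev : ∀ᶠ y in 𝓝[euclideanBox I] x, ∀ i, |G i y - G i x| < ε / N := by
    rw [eventually_all]
    intro i
    have := (Metric.tendsto_nhds.1 (hG i x hx)) (ε / N) (by positivity)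
    simpa [Real.dist_eq] using this
  obtain ⟨r, hr, hball⟩ := Metric.mem_nhdsWithin_iff.1 hev
  have hmem : ∀ᶠ y in 𝓝[euclideanBox I] x, y ∈ Metric.ball x r ∩ euclideanBox I :=
    inter_mem (mem_nhdsWithin_of_mem_nhds (Metric.ball_mem_nhds x hr)) self_mem_nhdsWithin
  filter_upwards [hmem] with y hy
  obtain ⟨hyr, hyB⟩ := hy
  -- The hybrid points `p s` lead from `x` to `y` by changing one coordinate at a time. All
  -- coordinates stay between those of `x` and `y`, so the path remains both in the box and in the
  -- ball where the partial derivatives are nearly constant.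
  let p : Finset ι → EuclideanSpace ℝ ι := fun s => WithLp.toLp 2 fun i => if i ∈ s then y i else x i
  have hclose : ∀ z : EuclideanSpace ℝ ι, (∀ i, z i ∈ Set.uIcc (x i) (y i)) →
      z ∈ euclideanBox I ∧ ∀ i, |G i z - G i x| ≤ ε / N := by
    intro z hz
    have hzB : z ∈ euclideanBox I := fun i => (hI i).uIcc_subset (hx i) (hyB i) (hz i)
    refine ⟨hzB, fun i => (hball ⟨?_, hzB⟩ i).le⟩
    rw [Metric.mem_ball, EuclideanSpace.dist_eq] at hyr ⊢
    refine lt_of_le_of_lt (Real.sqrt_le_sqrt (Finset.sum_le_sum fun i _ => ?_)) hyr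
    rw [Real.dist_eq, Real.dist_eq]
    exact pow_le_pow_left₀ (abs_nonneg _) (Set.abs_sub_left_of_mem_uIcc (hz i)) 2
  have main : ∀ s : Finset ι, |F (p s) - F x - ∑ i ∈ s, G i x * (y i - x i)| ≤
      ∑ i ∈ s, ε / N * |y i - x i| := by
    intro s
    induction s using Finset.induction_on with
    | empty =>
      have : p ∅ = x := by ext i; simp [p]
      simp [this]
    | insert j s hj ih =>
      have hstep : p (insert j s) = p s + (y j - x j) • EuclideanSpace.single j (1 : ℝ) := by
        ext i
        by_cases hij : i = j
        · subst hij; simp [p, hj]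
        · simp [p, hij]
      have hin : ∀ t ∈ Set.uIcc 0 (y j - x j), ∀ i,
          (p s + t • EuclideanSpace.single j (1 : ℝ)) i ∈ Set.uIcc (x i) (y i) := by
        intro t ht i
        by_cases hij : i = j
        · subst hij
          have : x i + t ∈ Set.uIcc (x i + 0) (x i + (y i - x i)) := by
            rw [← Set.image_const_add_uIcc]; exact ⟨t, ht, rfl⟩
          simpa [p, hj] using this
        · by_cases his : i ∈ s <;> simp [p, hij, his]
      have hmv := abs_sub_le_of_hasLineDerivWithinAt_single (m := G j x) (ε := ε / N)
        (fun t ht => (hclose _ (hin t ht)).1) (hF j) (fun t ht => (hclose _ (hin t ht)).2 j)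
      rw [← hstep] at hmv
      rw [Finset.sum_insert hj, Finset.sum_insert hj]
      calc _ = |(F (p (insert j s)) - F (p s) - G j x * (y j - x j)) +
            (F (p s) - F x - ∑ i ∈ s, G i x * (y i - x i))| := by congr 1; ring
        _ ≤ _ := (abs_add_le _ _).trans (add_le_add hmv ih)
  have hlast := main Finset.univ
  have hpu : p Finset.univ = y := by ext i; simp [p]
  rw [hpu] at hlast
  have hsum : ∑ i, ε / N * |y i - x i| ≤ ε * ‖y - x‖ := by
    calc ∑ i, ε / N * |y i - x i| ≤ ∑ _i : ι, ε / N * ‖y - x‖ := by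
          refine Finset.sum_le_sum fun i _ => mul_le_mul_of_nonneg_left ?_ (by positivity)
          simpa using PiLp.norm_apply_le (y - x) i
      _ = (Fintype.card ι) * (ε / N * ‖y - x‖) := by simp
      _ ≤ N * (ε / N * ‖y - x‖) := by gcongr; simp [N]
      _ = ε * ‖y - x‖ := by field_simp
  refine le_trans (le_of_eq ?_) (hlast.trans hsum)
  simp [Real.norm_eq_abs]

/-- Second-order expansion along a segment in a box, with the Hessian compared to a matrix. -/
theorem abs_taylor_two_le_of_euclideanBox {I : ι → Set ℝ} (hI : ∀ i, (I i).OrdConnected)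
    {F : EuclideanSpace ℝ ι → ℝ} {G : ι → EuclideanSpace ℝ ι → ℝ}
    {K : EuclideanSpace ℝ ι → Matrix ι ι ℝ}
    (hF : ∀ i, ∀ x ∈ euclideanBox I,
      HasLineDerivWithinAt ℝ F (G i x) (euclideanBox I) x (EuclideanSpace.single i 1))
    (hG : ∀ i j, ∀ x ∈ euclideanBox I,
      HasLineDerivWithinAt ℝ (G j) (K x i j) (euclideanBox I) x (EuclideanSpace.single i 1))
    (hGc : ∀ i, ContinuousOn (G i) (euclideanBox I))
    (hKc : ∀ i j, ContinuousOn (fun x => K x i j) (euclideanBox I))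
    {x y : EuclideanSpace ℝ ι} (hx : x ∈ euclideanBox I) (hy : y ∈ euclideanBox I)
    {A : Matrix ι ι ℝ} {c : ℝ}
    (hc : ∀ z ∈ euclideanBox I, ‖z - x‖ ≤ ‖y - x‖ → ‖K z - A‖ ≤ c) :
    |F y - F x - ∑ i, G i x * (y - x) i
      - (1 / 2) * inner ℝ (y - x) (Matrix.toEuclideanCLM (𝕜 := ℝ) A (y - x))| ≤
      c * ‖y - x‖ ^ 2 := by
  set h := y - x with hh
  set a : ℝ := inner ℝ h (Matrix.toEuclideanCLM (𝕜 := ℝ) A h) with ha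
  have hseg : ∀ t ∈ Set.Icc (0 : ℝ) 1, x + t • h ∈ euclideanBox I := by
    intro t ht
    have := (convex_euclideanBox hI).add_smul_sub_mem hx hy ht
    exact this
  have hline : ∀ t, HasDerivWithinAt (fun t : ℝ => x + t • h) h (Set.Icc 0 1) t := by
    intro t
    have := ((hasDerivAt_id t).smul_const h).const_add x
    simpa using this.hasDerivWithinAt
  have hφ : ∀ t ∈ Set.Icc (0 : ℝ) 1, HasDerivWithinAt (fun t : ℝ => F (x + t • h))
      (∑ i, G i (x + t • h) * h i) (Set.Icc 0 1) t := by
    intro t ht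
    have := (hasFDerivWithinAt_euclideanBox hI hF hGc (hseg t ht)).comp_hasDerivWithinAt t
      (hline t) (fun s hs => hseg s hs)
    simpa [Function.comp_def] using this
  have hφ' : ∀ t ∈ Set.Icc (0 : ℝ) 1, HasDerivWithinAt
      (fun t : ℝ => ∑ i, G i (x + t • h) * h i)
      (inner ℝ h (Matrix.toEuclideanCLM (𝕜 := ℝ) (K (x + t • h)) h)) (Set.Icc 0 1) t := by
    intro t ht
    have : HasDerivWithinAt (fun t : ℝ => ∑ j, G j (x + t • h) * h j)
        (∑ j, (∑ i, K (x + t • h) i j * h i) * h j) (Set.Icc 0 1) t := by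
      refine HasDerivWithinAt.fun_sum fun j _ => HasDerivWithinAt.mul_const ?_ _
      have := (hasFDerivWithinAt_euclideanBox hI (fun i => hG i j) (fun i => hKc i j)
        (hseg t ht)).comp_hasDerivWithinAt t (hline t) (fun s hs => hseg s hs)
      simpa [Function.comp_def] using this
    convert this using 1
    generalize K (x + t • h) = M
    rw [Matrix.inner_toEuclideanCLM]
    simp only [dotProduct, Matrix.mulVec, Finset.sum_mul, Finset.mul_sum]
    rw [Finset.sum_comm]
    exact Finset.sum_congr rfl fun i _ => Finset.sum_congr rfl fun j _ => by ring
  have hbound : ∀ t ∈ Set.Icc (0 : ℝ) 1,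
      |inner ℝ h (Matrix.toEuclideanCLM (𝕜 := ℝ) (K (x + t • h)) h) - a| ≤ c * ‖h‖ ^ 2 := by
    intro t ht
    have h1 : ‖K (x + t • h) - A‖ ≤ c := by
      refine hc _ (hseg t ht) ?_
      rw [add_sub_cancel_left, norm_smul, Real.norm_of_nonneg ht.1]
      exact mul_le_of_le_one_left (norm_nonneg _) ht.2
    rw [ha, ← inner_sub_right, ← sub_apply, ← map_sub]
    refine (abs_real_inner_le_norm _ _).trans ?_
    calc ‖h‖ * ‖Matrix.toEuclideanCLM (𝕜 := ℝ) (K (x + t • h) - A) h‖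
        ≤ ‖h‖ * (‖K (x + t • h) - A‖ * ‖h‖) := by
          gcongr
          exact ContinuousLinearMap.le_opNorm _ _
      _ ≤ ‖h‖ * (c * ‖h‖) := by gcongr
      _ = c * ‖h‖ ^ 2 := by ring
  set g0 : ℝ := ∑ i, G i x * h i with hg0
  -- The mean value inequality is used twice, on the first derivative and then on the function. The
  -- factor `t ≤ 1` is dropped here, which is why the remainder carries `c` and not `c / 2`.
  have hfirst : ∀ t ∈ Set.Icc (0 : ℝ) 1,
      |∑ i, G i (x + t • h) * h i - g0 - a * t| ≤ c * ‖h‖ ^ 2 := by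
    intro t ht
    have key := (convex_Icc (0 : ℝ) 1).norm_image_sub_le_of_norm_hasDerivWithin_le
      (f := fun t => ∑ i, G i (x + t • h) * h i - a * t)
      (f' := fun t => inner ℝ h (Matrix.toEuclideanCLM (𝕜 := ℝ) (K (x + t • h)) h) - a)
      (C := c * ‖h‖ ^ 2) (x := 0) (y := t)
      (fun s hs => by
        have h5 : HasDerivWithinAt (fun s : ℝ => a * s) (a * 1) (Set.Icc 0 1) s :=
          ((hasDerivAt_id s).const_mul a).hasDerivWithinAt
        simpa using (hφ' s hs).fun_sub h5)
      (fun s hs => hbound s hs) (by simp) ht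
    have hc0 : 0 ≤ c * ‖h‖ ^ 2 := (abs_nonneg _).trans (hbound t ht)
    simp only [Real.norm_eq_abs, zero_smul, add_zero, mul_zero, sub_zero] at key
    calc _ = |∑ i, G i (x + t • h) * h i - a * t - g0| := by congr 1; ring
      _ ≤ c * ‖h‖ ^ 2 * |t| := key
      _ ≤ c * ‖h‖ ^ 2 := by
        rw [abs_of_nonneg ht.1]
        exact mul_le_of_le_one_right hc0 ht.2
  have key := (convex_Icc (0 : ℝ) 1).norm_image_sub_le_of_norm_hasDerivWithin_le
    (f := fun t => F (x + t • h) - g0 * t - a / 2 * t ^ 2)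
    (f' := fun t => ∑ i, G i (x + t • h) * h i - g0 - a * t)
    (C := c * ‖h‖ ^ 2) (x := 0) (y := 1)
    (fun s hs => by
      have h5 : HasDerivWithinAt (fun s : ℝ => g0 * s) (g0 * 1) (Set.Icc 0 1) s :=
        ((hasDerivAt_id s).const_mul g0).hasDerivWithinAt
      have h6 : HasDerivWithinAt (fun s : ℝ => a / 2 * s ^ 2) (a * s) (Set.Icc 0 1) s := by
        have := ((hasDerivAt_pow 2 s).const_mul (a / 2)).hasDerivWithinAt (s := Set.Icc 0 1)
        rwa [show a / 2 * (((2 : ℕ) : ℝ) * s ^ (2 - 1)) = a * s by norm_num; ring] at this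
      simpa using ((hφ s hs).fun_sub h5).fun_sub h6)
    (fun s hs => hfirst s hs) (by simp) (by simp)
  simp only [Real.norm_eq_abs, zero_smul, add_zero, mul_zero, sub_zero, one_smul, one_pow, mul_one,
    abs_one, ne_eq, OfNat.ofNat_ne_zero, not_false_eq_true, zero_pow] at key
  have hxy : x + h = y := by simp [hh]
  rw [hxy] at key
  calc _ = |F y - g0 - a / 2 - F x| := by congr 1; ring
    _ ≤ _ := key

end Taylor

/-! ### Maximization of a concave quadratic function over a set -/

section QuadraticGain

variable {E : Type*} [NormedAddCommGroup E] [InnerProductSpace ℝ E]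

/-- The quadratic function `h ↦ 2 ⟪g, h⟫ - ⟪h, A h⟫`. -/
def quadGain (A : E →L[ℝ] E) (g h : E) : ℝ := 2 * inner ℝ g h - inner ℝ h (A h)

/-- The supremum of `quadGain A g` over `S`. -/
def maxGain (A : E →L[ℝ] E) (S : Set E) (g : E) : ℝ := sSup (quadGain A g '' S)

variable {A : E →L[ℝ] E} {c : ℝ}

/-- Coercivity gives the bound `2 ‖g‖ ‖h‖ - c ‖h‖²`, whose maximum over `‖h‖` is `‖g‖² / c`. -/
theorem bddAbove_quadGain (hc : 0 < c) (hA : ∀ h, c * ‖h‖ ^ 2 ≤ inner ℝ h (A h)) (S : Set E)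
    (g : E) : BddAbove (quadGain A g '' S) := by
  refine ⟨‖g‖ ^ 2 / c, ?_⟩
  rintro _ ⟨h, -, rfl⟩
  have h1 := real_inner_le_norm g h
  have h2 := hA h
  rw [quadGain, le_div_iff₀ hc]
  nlinarith [sq_nonneg (‖g‖ - c * ‖h‖)]

theorem quadGain_le_maxGain (hc : 0 < c) (hA : ∀ h, c * ‖h‖ ^ 2 ≤ inner ℝ h (A h)) {S : Set E}
    {h : E} (hh : h ∈ S) (g : E) : quadGain A g h ≤ maxGain A S g :=
  le_csSup (bddAbove_quadGain hc hA S g) ⟨h, hh, rfl⟩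

/-- For fixed `h` the gain is affine in `g`, and a supremum of affine functions is convex. -/
theorem convexOn_maxGain (hc : 0 < c) (hA : ∀ h, c * ‖h‖ ^ 2 ≤ inner ℝ h (A h)) {S : Set E}
    (hS : S.Nonempty) : ConvexOn ℝ Set.univ (maxGain A S) := by
  refine ⟨convex_univ, fun x _ y _ a b ha hb hab => csSup_le (hS.image _) ?_⟩
  rintro _ ⟨h, hh, rfl⟩
  have h1 := mul_le_mul_of_nonneg_left (quadGain_le_maxGain hc hA hh x) ha
  have h2 := mul_le_mul_of_nonneg_left (quadGain_le_maxGain hc hA hh y) hb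
  have h3 : quadGain A (a • x + b • y) h = a * quadGain A x h + b * quadGain A y h := by
    simp only [quadGain, inner_add_left, real_inner_smul_left]
    linear_combination (inner ℝ h (A h)) * hab
  simp only [smul_eq_mul]
  linarith

/-- A finite convex function on a finite-dimensional space is continuous. No regularity of `S` and
no control of maximizers is needed for the continuous mapping step. -/
theorem continuous_maxGain [FiniteDimensional ℝ E] (hc : 0 < c)
    (hA : ∀ h, c * ‖h‖ ^ 2 ≤ inner ℝ h (A h)) {S : Set E} (hS : S.Nonempty) :
    Continuous (maxGain A S) :=
  continuousOn_univ.1 ((convexOn_maxGain hc hA hS).continuousOn isOpen_univ)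

theorem abs_quadGain_sub_le {M R d : ℝ} {g h a : E} (hg : ‖g‖ ≤ M) (hh : ‖h‖ ≤ R)
    (ha : ‖a‖ ≤ R) (hd : ‖h - a‖ ≤ d) :
    |quadGain A g h - quadGain A g a| ≤ (2 * M + 2 * ‖A‖ * R) * d := by
  have e : quadGain A g h - quadGain A g a =
      2 * inner ℝ g (h - a) - inner ℝ (h - a) (A h) - inner ℝ a (A (h - a)) := by
    simp only [quadGain, map_sub, inner_sub_left, inner_sub_right]
    ring
  have hM : 0 ≤ M := (norm_nonneg _).trans hg
  have hR : 0 ≤ R := (norm_nonneg _).trans hh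
  have hd0 : 0 ≤ d := (norm_nonneg _).trans hd
  have h1 : |inner ℝ g (h - a)| ≤ M * d :=
    (abs_real_inner_le_norm _ _).trans (mul_le_mul hg hd (norm_nonneg _) hM)
  have h2 : |inner ℝ (h - a) (A h)| ≤ d * (‖A‖ * R) :=
    (abs_real_inner_le_norm _ _).trans (mul_le_mul hd ((A.le_opNorm h).trans (by gcongr))
      (norm_nonneg _) hd0)
  have h3 : |inner ℝ a (A (h - a))| ≤ R * (‖A‖ * d) :=
    (abs_real_inner_le_norm _ _).trans (mul_le_mul ha ((A.le_opNorm _).trans (by gcongr))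
      (norm_nonneg _) hR)
  rw [e]
  rw [abs_le] at *
  constructor <;> nlinarith

/-- If `ℓ` is close to `quadGain A g` on the part of `S'` within a large ball, and `S'` is close to
`S` there, then the maximum of `ℓ` over `S'` is close to the supremum of `quadGain A g` over `S`. -/
theorem exists_abs_sub_maxGain_le (hc : 0 < c) (hA : ∀ h, c * ‖h‖ ^ 2 ≤ inner ℝ h (A h))
    {M ε : ℝ} (hM : 0 ≤ M) (hε : 0 < ε) :
    ∃ η > 0, ∃ d > 0, ∃ R > 0, ∀ (S S' : Set E) (g : E) (ℓ : E → ℝ) (ρ : ℝ) (k : E),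
      0 ∈ S → 0 ∈ S' → (∀ h ∈ S', ‖h‖ ≤ R → ∃ a ∈ S, ‖h - a‖ ≤ d) →
      (∀ a ∈ S, ‖a‖ ≤ R → ∃ h ∈ S', ‖h - a‖ ≤ d) → ‖g‖ ≤ M → R ≤ ρ →
      (∀ h ∈ S', ‖h‖ ≤ ρ → |ℓ h - quadGain A g h| ≤ η * ‖h‖ ^ 2) →
      k ∈ S' → ‖k‖ ≤ ρ → (∀ h ∈ S', ℓ h ≤ ℓ k) → |ℓ k - maxGain A S g| ≤ ε := by
  -- Beyond radius `R₀` the gain is below `-1`, and it stays negative even after half the curvature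
  -- `c` is given up to the approximation error. Hence neither `k` nor a near-maximizer over `S` can
  -- lie there.
  set R₀ : ℝ := (4 * M + 2) / c + 1 with hR₀
  have hR₀pos : 1 ≤ R₀ := by rw [hR₀]; have : 0 ≤ (4 * M + 2) / c := by positivity
                             linarith
  have hR₀c : c * (R₀ - 1) = 4 * M + 2 := by rw [hR₀]; field_simp; ring
  set C : ℝ := 2 * M + 2 * ‖A‖ * (R₀ + 1) with hC
  have hC0 : 0 ≤ C := by positivity
  -- The error `ε` is split into thirds. `η` costs at most half the curvature and at most `ε / 3` on
  -- the ball of radius `R₀ + 1`; `d ≤ 1` keeps displaced points in that ball, where `C` is a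
  -- Lipschitz constant of the gain.
  refine ⟨min (c / 2) (ε / (3 * (R₀ + 1) ^ 2)), by positivity, min 1 (ε / (3 * (C + 1))),
    by positivity, R₀ + 1, by positivity, ?_⟩
  set η := min (c / 2) (ε / (3 * (R₀ + 1) ^ 2))
  set d := min 1 (ε / (3 * (C + 1)))
  intro S S' g ℓ ρ k h0S h0S' hS'S hSS' hg hρ hℓ hk hkρ hmax
  have hη1 : η ≤ c / 2 := min_le_left _ _
  have hη0 : 0 ≤ η := by positivity
  have hη2 : η * (R₀ + 1) ^ 2 ≤ ε / 3 := by
    have : η ≤ ε / (3 * (R₀ + 1) ^ 2) := min_le_right _ _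
    rw [le_div_iff₀ (by positivity)] at this
    linarith
  have hd1 : d ≤ 1 := min_le_left _ _
  have hd2 : C * d ≤ ε / 3 := by
    have h1 : d ≤ ε / (3 * (C + 1)) := min_le_right _ _
    have h2 : 0 ≤ d := by positivity
    rw [le_div_iff₀ (by positivity)] at h1
    nlinarith
  have hℓ0 : ℓ 0 = 0 := by
    have := hℓ 0 h0S' (by simp; linarith)
    simpa [quadGain] using this
  have hinner : ∀ h, inner ℝ g h ≤ M * ‖h‖ := fun h =>
    (real_inner_le_norm _ _).trans (by gcongr)
  have hkR : ‖k‖ ≤ R₀ := by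
    by_contra! hlt
    have h1 := hmax 0 h0S'
    have h2 := (abs_le.1 (hℓ k hk hkρ)).2
    have h3 := hA k
    have h4 := hinner k
    rw [hℓ0] at h1
    unfold quadGain at h2
    have h5 : 0 ≤ (2 * M - c / 2 * ‖k‖) * ‖k‖ := by nlinarith [sq_nonneg ‖k‖]
    have h6 : c * (R₀ - 1) ≤ c * ‖k‖ := mul_le_mul_of_nonneg_left (by linarith) hc.le
    nlinarith
  have herr : ∀ h ∈ S', ‖h‖ ≤ R₀ + 1 → |ℓ h - quadGain A g h| ≤ ε / 3 := by
    intro h hh hhR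
    refine (hℓ h hh (hhR.trans hρ)).trans (le_trans ?_ hη2)
    gcongr
  rw [abs_le]
  constructor
  · by_contra! hlt
    -- A near-maximizer replaces a maximizer over `S`. The slack `1` forces its gain above `-1`,
    -- hence its norm below `R₀`; the slack `ε / 3` is its share of the error.
    have hex : maxGain A S g - min (ε / 3) 1 < maxGain A S g := by
      have : 0 < min (ε / 3) 1 := by positivity
      linarith
    obtain ⟨_, ⟨a, ha, rfl⟩, hagt⟩ := exists_lt_of_lt_csSup (Set.Nonempty.image _ ⟨0, h0S⟩) hex
    have hV0 : 0 ≤ maxGain A S g := by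
      have := quadGain_le_maxGain hc hA h0S g
      simpa [quadGain] using this
    have haR : ‖a‖ ≤ R₀ := by
      by_contra! hlt'
      have h3 := hA a
      have h4 := hinner a
      have h7 : min (ε / 3) 1 ≤ 1 := min_le_right _ _
      unfold quadGain at hagt
      have h6 : c * (R₀ - 1) ≤ c * ‖a‖ := mul_le_mul_of_nonneg_left (by linarith) hc.le
      nlinarith
    obtain ⟨h, hh, hha⟩ := hSS' a ha (by linarith)
    have hhR : ‖h‖ ≤ R₀ + 1 := by
      calc ‖h‖ = ‖a + (h - a)‖ := by congr 1; abel
        _ ≤ ‖a‖ + ‖h - a‖ := norm_add_le _ _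
        _ ≤ R₀ + 1 := by linarith
    have h1 := (abs_le.1 (herr h hh hhR)).1
    have h2 := (abs_le.1 (abs_quadGain_sub_le (A := A) hg hhR (by linarith) hha)).1
    have h3 := hmax h hh
    have h4 : min (ε / 3) 1 ≤ ε / 3 := min_le_left _ _
    linarith
  · obtain ⟨a, ha, hka⟩ := hS'S k hk (by linarith)
    have haR : ‖a‖ ≤ R₀ + 1 := by
      calc ‖a‖ = ‖k - (k - a)‖ := by congr 1; abel
        _ ≤ ‖k‖ + ‖k - a‖ := norm_sub_le _ _
        _ ≤ R₀ + 1 := by linarith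
    have h1 := (abs_le.1 (herr k hk (by linarith))).2
    have h2 := (abs_le.1 (abs_quadGain_sub_le (A := A) hg (by linarith) haR hka)).2
    have h3 := quadGain_le_maxGain hc hA ha g
    linarith

end QuadraticGain

/-! ### Partial minimization of the quadratic form -/

/-- A positive definite matrix is coercive. -/
theorem Matrix.PosDef.exists_mul_norm_sq_le {ι : Type*} [Fintype ι] [DecidableEq ι]
    {A : Matrix ι ι ℝ} (hA : A.PosDef) :
    ∃ c > 0, ∀ h : EuclideanSpace ℝ ι,
      c * ‖h‖ ^ 2 ≤ inner ℝ h (Matrix.toEuclideanCLM (𝕜 := ℝ) A h) := by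
  set B := Matrix.toEuclideanCLM (𝕜 := ℝ) A
  have hpos : ∀ h : EuclideanSpace ℝ ι, h ≠ 0 → 0 < inner ℝ h (B h) := by
    intro h hh
    have h1 : (h : ι → ℝ) ≠ 0 := fun h0 => hh (by ext i; simp [h0])
    have := hA.dotProduct_mulVec_pos h1
    rw [Matrix.inner_toEuclideanCLM]
    simpa using this
  have hcont : Continuous fun h : EuclideanSpace ℝ ι => inner ℝ h (B h) := by fun_prop
  rcases (Metric.sphere (0 : EuclideanSpace ℝ ι) 1).eq_empty_or_nonempty with hS | hS
  · refine ⟨1, one_pos, fun h => ?_⟩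
    have : h = 0 := by
      by_contra hh
      have hmem : (‖h‖⁻¹ • h) ∈ Metric.sphere (0 : EuclideanSpace ℝ ι) 1 := by
        simp [norm_smul, hh]
      rw [hS] at hmem
      exact hmem
    simp [this]
  · obtain ⟨x, hx, hmin⟩ := (isCompact_sphere (0 : EuclideanSpace ℝ ι) 1).exists_isMinOn hS
      hcont.continuousOn
    have hx0 : x ≠ 0 := by
      rintro rfl
      simp at hx
    refine ⟨_, hpos x hx0, fun h => ?_⟩
    by_cases hh : h = 0
    · simp [hh]
    have hmem : (‖h‖⁻¹ • h) ∈ Metric.sphere (0 : EuclideanSpace ℝ ι) 1 := by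
      simp [norm_smul, hh]
    have h1 := isMinOn_iff.1 hmin _ hmem
    rw [map_smul, real_inner_smul_left, real_inner_smul_right] at h1
    have h2 : 0 < ‖h‖ := norm_pos_iff.2 hh
    have h3 : ‖h‖⁻¹ * (‖h‖⁻¹ * inner ℝ h (B h)) * ‖h‖ ^ 2 = inner ℝ h (B h) := by field_simp
    rw [← h3]
    gcongr

section Partial

variable {Ω₀ : Matrix (Idx dγ dβ dδ) (Idx dγ dβ dδ) ℝ}

theorem selH_mulVec (z : Idx dγ dβ dδ → ℝ) :
    selH dγ dβ dδ *ᵥ z = fun i => z (.inl i) := by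
  ext i
  simp [selH, Matrix.fromCols, Matrix.mulVec, dotProduct, Fintype.sum_sum_type, Matrix.one_apply]

/-- `H` has full row rank: the leading coordinates of `v H` are `v` itself. -/
theorem posDef_selH_mul_inv_mul (hΩ : Ω₀.PosDef) :
    (selH dγ dβ dδ * Ω₀⁻¹ * (selH dγ dβ dδ)ᵀ).PosDef := by
  refine hΩ.inv.mul_mul_conjTranspose_same fun v w hvw => ?_
  ext i
  have h1 := congrFun hvw (.inl i)
  simpa [selH] using h1

/-- The minimizer of the quadratic form of `Ω₀` among the vectors `s` with `H s = w`. -/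
def profileLift (Ω₀ : Matrix (Idx dγ dβ dδ) (Idx dγ dβ dδ) ℝ) (w : Fin dγ ⊕ Fin dβ → ℝ) :
    Idx dγ dβ dδ → ℝ :=
  Ω₀⁻¹ *ᵥ ((selH dγ dβ dδ)ᵀ *ᵥ ((selH dγ dβ dδ * Ω₀⁻¹ * (selH dγ dβ dδ)ᵀ)⁻¹ *ᵥ w))

/-- These are the Lagrange conditions of the constrained minimization: feasibility, and a gradient
in the range of `H'`. -/
theorem mulVec_profileLift (hΩ : Ω₀.PosDef) (w : Fin dγ ⊕ Fin dβ → ℝ) :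
    Ω₀ *ᵥ profileLift Ω₀ w =
      (selH dγ dβ dδ)ᵀ *ᵥ ((selH dγ dβ dδ * Ω₀⁻¹ * (selH dγ dβ dδ)ᵀ)⁻¹ *ᵥ w) ∧
    selH dγ dβ dδ *ᵥ profileLift Ω₀ w = w := by
  have h1 : IsUnit Ω₀.det := (Matrix.isUnit_iff_isUnit_det _).1 hΩ.isUnit
  have h2 := (Matrix.isUnit_iff_isUnit_det _).1 (posDef_selH_mul_inv_mul hΩ).isUnit
  constructor
  · rw [profileLift, Matrix.mulVec_mulVec, Matrix.mul_nonsing_inv _ h1, Matrix.one_mulVec]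
  · rw [profileLift, Matrix.mulVec_mulVec, Matrix.mulVec_mulVec, Matrix.mulVec_mulVec,
      Matrix.mul_nonsing_inv _ h2, Matrix.one_mulVec]

/-- The quadratic form of `Ω₀` dominates the profiled one. -/
theorem quadQ_le (hΩ : Ω₀.PosDef) (z h : Par dγ dβ dδ) :
    quadQ Ω₀ z (fun i => h (.inl i)) ≤
      inner ℝ (h - z) (Matrix.toEuclideanCLM (𝕜 := ℝ) Ω₀ (h - z)) := by
  set H := selH dγ dβ dδ with hH
  set K := H * Ω₀⁻¹ * Hᵀ with hK
  obtain ⟨u, hu⟩ : ∃ u : Idx dγ dβ dδ → ℝ, u = (h : Idx dγ dβ dδ → ℝ) - z := ⟨_, rfl⟩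
  set w := H *ᵥ u with hw
  have hwv : (fun i => h (.inl i)) - H *ᵥ z = w := by
    rw [hw, hu, hH, selH_mulVec, selH_mulVec]
    ext i
    simp
  obtain ⟨hΩu, hHu⟩ := mulVec_profileLift hΩ w
  set s := profileLift Ω₀ w
  have hsymm : Ω₀ᵀ = Ω₀ := hΩ.isHermitian.eq
  -- The `Ω₀`-product with `s` depends on `x` only through `H x`. As `u` and `s` have the same image
  -- `w`, the cross terms collapse, and the inequality becomes the Pythagorean identity in `hexp`.
  have hcross : ∀ x, x ⬝ᵥ Ω₀ *ᵥ s = (H *ᵥ x) ⬝ᵥ K⁻¹ *ᵥ w := by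
    intro x
    rw [hΩu, Matrix.dotProduct_mulVec, Matrix.vecMul_transpose]
  have hcross' : s ⬝ᵥ Ω₀ *ᵥ u = u ⬝ᵥ Ω₀ *ᵥ s := by
    rw [Matrix.dotProduct_mulVec, ← Matrix.mulVec_transpose, hsymm, dotProduct_comm]
  have hnn : 0 ≤ (u - s) ⬝ᵥ Ω₀ *ᵥ (u - s) := by
    simpa using hΩ.posSemidef.dotProduct_mulVec_nonneg (u - s)
  have hexp : (u - s) ⬝ᵥ Ω₀ *ᵥ (u - s) = u ⬝ᵥ Ω₀ *ᵥ u - w ⬝ᵥ K⁻¹ *ᵥ w := by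
    rw [Matrix.mulVec_sub, dotProduct_sub, sub_dotProduct, sub_dotProduct, hcross', hcross,
      hcross, ← hw, show H *ᵥ s = w from hHu]
    ring
  rw [quadQ, Matrix.inner_toEuclideanCLM]
  change ((fun i => h (.inl i)) - H *ᵥ z) ⬝ᵥ (K⁻¹ *ᵥ ((fun i => h (.inl i)) - H *ᵥ z)) ≤ _
  rw [hwv]
  rw [WithLp.ofLp_sub, ← hu]
  linarith

/-- The profiled quadratic form is attained at a suitable completion of the vector. -/
theorem exists_inner_eq_quadQ (hΩ : Ω₀.PosDef) (z : Par dγ dβ dδ) (v : Fin dγ ⊕ Fin dβ → ℝ) :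
    ∃ h : Par dγ dβ dδ, (fun i => h (.inl i)) = v ∧
      inner ℝ (h - z) (Matrix.toEuclideanCLM (𝕜 := ℝ) Ω₀ (h - z)) = quadQ Ω₀ z v := by
  set w := v - selH dγ dβ dδ *ᵥ z with hw
  obtain ⟨hΩu, hHu⟩ := mulVec_profileLift hΩ w
  set s := profileLift Ω₀ w
  refine ⟨z + WithLp.toLp 2 s, ?_, ?_⟩
  · ext i
    have h1 := congrFun hHu i
    rw [hw, selH_mulVec, selH_mulVec] at h1
    simp only [Pi.sub_apply] at h1
    simp [h1]
  · rw [add_sub_cancel_left, Matrix.inner_toEuclideanCLM]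
    change s ⬝ᵥ Ω₀ *ᵥ s = _
    rw [hΩu, Matrix.dotProduct_mulVec, Matrix.vecMul_transpose, hHu, quadQ]

/-- The vectors whose `(γ, β)`-part lies in `V`. -/
def cylinderOver (V : Set (Fin dγ ⊕ Fin dβ → ℝ)) : Set (Par dγ dβ dδ) :=
  {h | (fun i => h (.inl i)) ∈ V}

/-- Completing the square, the gain at `g = Ω₀ z` is `⟪z, Ω₀ z⟫` minus the squared `Ω₀`-distance
from `h` to `z`. In the cylinder the `δ`-part is free, and minimizing over it leaves `quadQ`. -/
theorem sInf_quadQ_eq (hΩ : Ω₀.PosDef) (z : Par dγ dβ dδ) {V : Set (Fin dγ ⊕ Fin dβ → ℝ)}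
    (hV : V.Nonempty) :
    sInf (quadQ Ω₀ z '' V) = inner ℝ z (Matrix.toEuclideanCLM (𝕜 := ℝ) Ω₀ z) -
      maxGain (Matrix.toEuclideanCLM (𝕜 := ℝ) Ω₀) (cylinderOver V)
        (Matrix.toEuclideanCLM (𝕜 := ℝ) Ω₀ z) := by
  obtain ⟨c, hc, hA⟩ := hΩ.exists_mul_norm_sq_le
  set A := Matrix.toEuclideanCLM (𝕜 := ℝ) Ω₀
  have hsymm : ∀ x y : Par dγ dβ dδ, inner ℝ (A x) y = inner ℝ x (A y) := by
    intro x y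
    have h1 : Ω₀ᵀ = Ω₀ := hΩ.isHermitian.eq
    rw [real_inner_comm, Matrix.inner_toEuclideanCLM, Matrix.inner_toEuclideanCLM,
      Matrix.dotProduct_mulVec, ← Matrix.mulVec_transpose, h1, dotProduct_comm]
  have hgain : ∀ h, quadGain A (A z) h = inner ℝ z (A z) - inner ℝ (h - z) (A (h - z)) := by
    intro h
    have := hsymm z h
    simp only [quadGain, map_sub, inner_sub_left, inner_sub_right, real_inner_comm (A z) h] at *
    linarith
  have hne : (cylinderOver V : Set (Par dγ dβ dδ)).Nonempty := by
    obtain ⟨v, hv⟩ := hV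
    obtain ⟨h, hh, -⟩ := exists_inner_eq_quadQ hΩ z v
    exact ⟨h, by simpa [cylinderOver, hh] using hv⟩
  have hbdd : ∀ v ∈ V, inner ℝ z (A z) - maxGain A (cylinderOver V) (A z) ≤ quadQ Ω₀ z v := by
    intro v hv
    obtain ⟨h, hh, heq⟩ := exists_inner_eq_quadQ hΩ z v
    have h1 : h ∈ (cylinderOver V : Set (Par dγ dβ dδ)) := by simpa [cylinderOver, hh] using hv
    have h2 := quadGain_le_maxGain hc hA h1 (A z)
    rw [hgain h, heq] at h2
    linarith
  apply le_antisymm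
  · rw [le_sub_comm]
    refine csSup_le (hne.image _) ?_
    rintro _ ⟨h, hh, rfl⟩
    have h1 : sInf (quadQ Ω₀ z '' V) ≤ quadQ Ω₀ z (fun i => h (.inl i)) :=
      csInf_le ⟨_, by rintro _ ⟨v, hv, rfl⟩; exact hbdd v hv⟩ ⟨_, hh, rfl⟩
    have h2 := quadQ_le hΩ z h
    rw [hgain h]
    linarith
  · refine le_csInf (hV.image _) ?_
    rintro _ ⟨v, hv, rfl⟩
    exact hbdd v hv

end Partial

/-! ### Local approximation of the rescaled parameter space -/

section LocalSets

/-- `h` with its `β`-part replaced by `v`. -/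
def withBet (h : Par dγ dβ dδ) (v : Fin dβ → ℝ) : Par dγ dβ dδ :=
  WithLp.toLp 2 (Sum.elim (Sum.elim (gam h) v) (del h))

theorem EuclideanSpace.norm_le_of_forall_abs_le {ι : Type*} [Fintype ι] {v : EuclideanSpace ℝ ι}
    {d : ℝ} (h : ∀ i, |v i| ≤ d / (Fintype.card ι + 1)) (hd : 0 ≤ d) : ‖v‖ ≤ d := by
  rw [EuclideanSpace.norm_eq]
  refine Real.sqrt_le_iff.2 ⟨hd, ?_⟩
  calc ∑ i, ‖v i‖ ^ 2 ≤ ∑ _i : ι, (d / (Fintype.card ι + 1)) ^ 2 :=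
        Finset.sum_le_sum fun i _ => pow_le_pow_left₀ (norm_nonneg _) (h i) 2
    _ = Fintype.card ι / (Fintype.card ι + 1) ^ 2 * d ^ 2 := by
        simp only [Finset.sum_const, Finset.card_univ, nsmul_eq_mul]
        field_simp
    _ ≤ 1 * d ^ 2 := by
        gcongr
        rw [div_le_one (by positivity)]
        nlinarith [(Nat.cast_nonneg (Fintype.card ι) : (0 : ℝ) ≤ Fintype.card ι)]
    _ = d ^ 2 := one_mul _

theorem norm_withBet_sub_le {h : Par dγ dβ dδ} {v : Fin dβ → ℝ} {d : ℝ} (hd : 0 ≤ d)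
    (hv : ∀ i, |v i - bet h i| ≤ d / (Fintype.card (Idx dγ dβ dδ) + 1)) :
    ‖withBet h v - h‖ ≤ d := by
  have h0 : 0 ≤ d / (Fintype.card (Idx dγ dβ dδ) + 1 : ℝ) := by positivity
  refine EuclideanSpace.norm_le_of_forall_abs_le (fun i => ?_) hd
  rcases i with (i | i) | i
  · simpa [withBet, gam] using h0
  · exact hv i
  · simpa [withBet, del] using h0

theorem neg_coe_le_coe_iff (x : ℝ≥0∞) (t : ℝ) :
    -(x : EReal) ≤ (t : EReal) ↔ (x ≠ ⊤ → -x.toReal ≤ t) := by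
  induction x with
  | top => simp
  | coe x =>
    have : -(((x : ℝ≥0∞) : EReal)) = ((-(x : ℝ) : ℝ) : EReal) := rfl
    rw [this, EReal.coe_le_coe_iff]
    simp

theorem eventually_coe_le_of_tendsto {x : ℕ → ℝ} {a : ℝ} {u : EReal} (hx : Tendsto x atTop (𝓝 a))
    (hu : (a : EReal) < u) : ∀ᶠ n in atTop, (x n : EReal) ≤ u :=
  (((continuous_coe_real_ereal.tendsto a).comp hx).eventually_lt_const hu).mono fun _ h => h.le

theorem eventually_le_coe_of_tendsto {x : ℕ → ℝ} {a : ℝ} {u : EReal} (hx : Tendsto x atTop (𝓝 a))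
    (hu : u < (a : EReal)) : ∀ᶠ n in atTop, u ≤ (x n : EReal) :=
  (((continuous_coe_real_ereal.tendsto a).comp hx).eventually_const_lt hu).mono fun _ h => h.le

theorem tendsto_inv_sqrt_natCast : Tendsto (fun n : ℕ => (√(n : ℝ))⁻¹) atTop (𝓝 0) :=
  tendsto_inv_atTop_zero.comp (Real.tendsto_sqrt_atTop.comp tendsto_natCast_atTop_atTop)

variable {s : ℕ} {γL γU βU : EReal} {γ₀ : Fin dγ → ℝ}

/-- A binding end point is respected for every `n` by the sign condition in `Λ_γ`. A non-binding one
is eventually out of reach of shifts of size `R / √n`, uniformly in `t`. -/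
theorem eventually_add_mem_ThetaGamma (hγ₀ : γ₀ ∈ ThetaGamma dγ s γL γU) (R : ℝ) :
    ∀ᶠ n : ℕ in atTop, ∀ t ∈ LambdaGamma s γL γU γ₀, (∀ i, |t i| ≤ R) →
      (fun i => γ₀ i + (√(n : ℝ))⁻¹ * t i) ∈ ThetaGamma dγ s γL γU := by
  have hlim : ∀ (i : Fin dγ) (c : ℝ),
      Tendsto (fun n : ℕ => γ₀ i + (√(n : ℝ))⁻¹ * c) atTop (𝓝 (γ₀ i)) := fun i c => by
    simpa using (tendsto_inv_sqrt_natCast.mul_const c).const_add (γ₀ i)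
  have key : ∀ᶠ n : ℕ in atTop, ∀ i, ∀ t : ℝ, |t| ≤ R →
      ((γ₀ i : EReal) = gammaLower s γL i → 0 ≤ t) → ((γ₀ i : EReal) = γU → t ≤ 0) →
      gammaLower s γL i ≤ ((γ₀ i + (√(n : ℝ))⁻¹ * t : ℝ) : EReal) ∧
        ((γ₀ i + (√(n : ℝ))⁻¹ * t : ℝ) : EReal) ≤ γU := by
    rw [eventually_all]
    intro i
    have hlow : ∀ᶠ n : ℕ in atTop, ∀ t : ℝ, |t| ≤ R →
        ((γ₀ i : EReal) = gammaLower s γL i → 0 ≤ t) →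
        gammaLower s γL i ≤ ((γ₀ i + (√(n : ℝ))⁻¹ * t : ℝ) : EReal) := by
      rcases (hγ₀ i).1.eq_or_lt with he | hlt
      · refine Eventually.of_forall fun n t _ h1 => ?_
        have := h1 he.symm
        rw [he, EReal.coe_le_coe_iff]
        have : 0 ≤ (√(n : ℝ))⁻¹ * t := by positivity
        linarith
      · filter_upwards [eventually_le_coe_of_tendsto (hlim i (-R)) hlt] with n hn t ht _
        refine hn.trans (EReal.coe_le_coe_iff.2 ?_)
        have := (abs_le.1 ht).1
        gcongr
    have hup : ∀ᶠ n : ℕ in atTop, ∀ t : ℝ, |t| ≤ R → ((γ₀ i : EReal) = γU → t ≤ 0) →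
        ((γ₀ i + (√(n : ℝ))⁻¹ * t : ℝ) : EReal) ≤ γU := by
      rcases (hγ₀ i).2.eq_or_lt with he | hlt
      · refine Eventually.of_forall fun n t _ h1 => ?_
        have := h1 he
        rw [← he, EReal.coe_le_coe_iff]
        have : (√(n : ℝ))⁻¹ * t ≤ 0 := mul_nonpos_of_nonneg_of_nonpos (by positivity) this
        linarith
      · filter_upwards [eventually_coe_le_of_tendsto (hlim i R) hlt] with n hn t ht _
        refine le_trans (EReal.coe_le_coe_iff.2 ?_) hn
        have := (abs_le.1 ht).2
        gcongr
    filter_upwards [hlow, hup] with n h1 h2 t ht ha hb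
    exact ⟨h1 t ht ha, h2 t ht hb⟩
  filter_upwards [key] with n hn t ht htR i
  exact hn i (t i) (htR i) (ht i trivial).1 (ht i trivial).2

theorem mem_LambdaGamma_of_add_mem {r : ℝ} (hr : 0 < r) {t : Fin dγ → ℝ}
    (ht : (fun i => γ₀ i + r * t i) ∈ ThetaGamma dγ s γL γU) : t ∈ LambdaGamma s γL γU γ₀ := by
  intro i _
  obtain ⟨h1, h2⟩ := ht i
  constructor
  · intro he
    rw [← he, EReal.coe_le_coe_iff] at h1
    exact nonneg_of_mul_nonneg_right (by linarith) hr
  · intro he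
    rw [← he, EReal.coe_le_coe_iff] at h2
    exact nonpos_of_mul_nonpos_right (by linarith) hr

theorem zero_mem_LambdaGamma : (0 : Fin dγ → ℝ) ∈ LambdaGamma s γL γU γ₀ :=
  fun _ _ => ⟨fun _ => le_rfl, fun _ => le_rfl⟩

theorem isClosed_LambdaGamma : IsClosed (LambdaGamma s γL γU γ₀) := by
  refine isClosed_set_pi fun i _ => ?_
  rw [Set.ofPred_and]
  refine IsClosed.inter ?_ ?_
  · by_cases h : (γ₀ i : EReal) = gammaLower s γL i
    · simpa [h, Set.Ici] using isClosed_Ici (a := (0 : ℝ))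
    · simp [h]
  · by_cases h : (γ₀ i : EReal) = γU
    · simpa [h, Set.Iic] using isClosed_Iic (a := (0 : ℝ))
    · simp [h]

/-- All rescaled sets lie in the closed set `Λ_γ`, and each point of `Λ_γ` eventually belongs to
them, so the inner and outer limits coincide. -/
theorem setConverges_ThetaGamma (hγ₀ : γ₀ ∈ ThetaGamma dγ s γL γU) :
    SetConverges (fun n : ℕ => (fun g => √(n : ℝ) • (g - γ₀)) '' ThetaGamma dγ s γL γU)
      (LambdaGamma s γL γU γ₀) := by
  have hsub : ∀ n : ℕ, (fun g => √(n : ℝ) • (g - γ₀)) '' ThetaGamma dγ s γL γU ⊆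
      LambdaGamma s γL γU γ₀ := by
    rintro n _ ⟨g, hg, rfl⟩
    -- At `n = 0` the scaling factor vanishes and the image contains only the origin.
    rcases Nat.eq_zero_or_pos n with rfl | hn
    · simpa using zero_mem_LambdaGamma
    have hr : 0 < √(n : ℝ) := Real.sqrt_pos.2 (by exact_mod_cast hn)
    refine mem_LambdaGamma_of_add_mem (inv_pos.2 hr) ?_
    convert hg using 1
    ext i
    simp only [Pi.smul_apply, Pi.sub_apply, smul_eq_mul]
    field_simp
    ring
  have hmem : ∀ x ∈ LambdaGamma s γL γU γ₀, ∀ᶠ n : ℕ in atTop,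
      x ∈ (fun g => √(n : ℝ) • (g - γ₀)) '' ThetaGamma dγ s γL γU := by
    intro x hx
    filter_upwards [eventually_add_mem_ThetaGamma hγ₀ ‖x‖, eventually_gt_atTop 0] with n hn hn0
    have hr : 0 < √(n : ℝ) := Real.sqrt_pos.2 (by exact_mod_cast hn0)
    refine ⟨_, hn x hx fun i => norm_le_pi_norm x i, ?_⟩
    ext i
    simp only [Pi.smul_apply, Pi.sub_apply, smul_eq_mul]
    field_simp
    ring
  have h1 : LambdaGamma s γL γU γ₀ ⊆ {x | ∀ U ∈ 𝓝 x, ∀ᶠ n : ℕ in atTop,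
      ((fun g => √(n : ℝ) • (g - γ₀)) '' ThetaGamma dγ s γL γU ∩ U).Nonempty} :=
    fun x hx U hU => (hmem x hx).mono fun n hn => ⟨x, hn, mem_of_mem_nhds hU⟩
  have h2 : {x | ∀ U ∈ 𝓝 x, ∃ᶠ n : ℕ in atTop,
      ((fun g => √(n : ℝ) • (g - γ₀)) '' ThetaGamma dγ s γL γU ∩ U).Nonempty} ⊆
      LambdaGamma s γL γU γ₀ := by
    intro x hx
    rw [← isClosed_LambdaGamma.closure_eq, mem_closure_iff_nhds]
    intro U hU
    obtain ⟨n, y, hy, hyU⟩ := (hx U hU).exists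
    exact ⟨y, hyU, hsub n hy⟩
  have h3 : {x | ∀ U ∈ 𝓝 x, ∀ᶠ n : ℕ in atTop,
      ((fun g => √(n : ℝ) • (g - γ₀)) '' ThetaGamma dγ s γL γU ∩ U).Nonempty} ⊆
      {x | ∀ U ∈ 𝓝 x, ∃ᶠ n : ℕ in atTop,
      ((fun g => √(n : ℝ) • (g - γ₀)) '' ThetaGamma dγ s γL γU ∩ U).Nonempty} :=
    fun x hx U hU => (hx U hU).frequently
  exact ⟨h1.antisymm (h3.trans h2), (h1.trans h3).antisymm h2⟩

/-- The limit of the rescaled ranges of `β`, one coordinate at a time. -/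
theorem eventually_beta_approx {u : ℕ → ℝ} {b : ℝ≥0∞} (hu : ∀ n, 0 ≤ u n)
    (hb : Tendsto (fun n => ENNReal.ofReal (u n)) atTop (𝓝 b)) (R : ℝ) {d : ℝ} (hd : 0 < d) :
    ∀ᶠ n in atTop, (∀ t, -u n ≤ t → ∃ a : ℝ, -(b : EReal) ≤ (a : EReal) ∧ |a - t| ≤ d) ∧
      ∀ a : ℝ, -(b : EReal) ≤ (a : EReal) → |a| ≤ R → |max a (-u n) - a| ≤ d := by
  rcases eq_or_ne b ⊤ with rfl | hbt
  · have hR : ∀ᶠ n in atTop, ENNReal.ofReal R < ENNReal.ofReal (u n) :=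
      hb.eventually_const_lt ENNReal.ofReal_lt_top
    filter_upwards [hR] with n hn
    refine ⟨fun t _ => ⟨t, by simp, by simpa using hd.le⟩, fun a _ haR => ?_⟩
    have h1 : R < u n := lt_of_not_ge fun h => hn.not_ge (ENNReal.ofReal_le_ofReal h)
    rw [max_eq_left (by linarith [(abs_le.1 haR).1])]
    simpa using hd.le
  -- For finite `b`, truncating at `-b` a point above `-u n`, or conversely, moves it by at most `|u
  -- n - b|`.
  · have h1 : Tendsto u atTop (𝓝 b.toReal) := by
      have := (ENNReal.tendsto_toReal hbt).comp hb
      refine this.congr fun n => ?_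
      simp [ENNReal.toReal_ofReal (hu n)]
    filter_upwards [(Metric.tendsto_nhds.1 h1) d hd] with n hn
    rw [Real.dist_eq, abs_lt] at hn
    refine ⟨fun t ht => ⟨max t (-b.toReal), ?_, ?_⟩, fun a ha _ => ?_⟩
    · rw [neg_coe_le_coe_iff]
      exact fun _ => le_max_right _ _
    · rcases max_cases t (-b.toReal) with ⟨h, h'⟩ | ⟨h, h'⟩ <;> rw [h, abs_le] <;>
        constructor <;> linarith
    · rw [neg_coe_le_coe_iff] at ha
      have := ha hbt
      rcases max_cases a (-u n) with ⟨h, h'⟩ | ⟨h, h'⟩ <;> rw [h, abs_le] <;>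
        constructor <;> linarith

variable {Θδ : Set (Fin dδ → ℝ)} {θ : ℕ → Par dγ dβ dδ} {θ₀ : Par dγ dβ dδ}
  {b : Fin dβ → ℝ≥0∞}

theorem continuous_bet : Continuous (bet : Par dγ dβ dδ → Fin dβ → ℝ) := by
  unfold bet; fun_prop

theorem continuous_del : Continuous (del : Par dγ dβ dδ → Fin dδ → ℝ) := by
  unfold del; fun_prop

theorem norm_del_le (h : Par dγ dβ dδ) : ‖del h‖ ≤ ‖h‖ :=
  (pi_norm_le_iff_of_nonneg (norm_nonneg _)).2 fun i => PiLp.norm_apply_le h (.inr i)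

/-- The rescaled parameter space `√n (Θ - θ_n)` and the cone `Λ_γ × Λ_β(b) × ℝ^dδ` approximate each
other locally, by points with the same `γ`-part. -/
theorem eventually_local_approx
    (hnull : ∀ n, θ n ∈ ThetaNull (Theta s γL γU βU Θδ) γ₀) (hθ : Tendsto θ atTop (𝓝 θ₀))
    (hb : ∀ i, Tendsto (fun n : ℕ => ENNReal.ofReal (√(n : ℝ) * bet (θ n) i)) atTop (𝓝 (b i)))
    (hβ₀ : ∀ i, (bet θ₀ i : EReal) < βU) (hδ₀ : del θ₀ ∈ interior Θδ) (R : ℝ) {d : ℝ}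
    (hd : 0 < d) :
    ∀ᶠ n : ℕ in atTop,
      (∀ h : Par dγ dβ dδ, θ n + (√(n : ℝ))⁻¹ • h ∈ Theta s γL γU βU Θδ →
        ∃ a ∈ cylinderOver (stack (LambdaGamma s γL γU γ₀) (LambdaBeta b)),
          ‖h - a‖ ≤ d ∧ gam a = gam h) ∧
      ∀ a ∈ cylinderOver (dδ := dδ) (stack (LambdaGamma s γL γU γ₀) (LambdaBeta b)), ‖a‖ ≤ R →
        ∃ h : Par dγ dβ dδ, θ n + (√(n : ℝ))⁻¹ • h ∈ Theta s γL γU βU Θδ ∧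
          ‖h - a‖ ≤ d ∧ gam h = gam a := by
  have hγ₀ : γ₀ ∈ ThetaGamma dγ s γL γU := (hnull 0).2 ▸ (hnull 0).1.1
  set d' : ℝ := d / (Fintype.card (Idx dγ dβ dδ) + 1)
  have hd' : 0 < d' := by positivity
  have hβ0 : ∀ n i, 0 ≤ bet (θ n) i := fun n i => ((hnull n).1.2.1 i).1
  have hβ : ∀ᶠ n : ℕ in atTop, ∀ i,
      (∀ t, -(√(n : ℝ) * bet (θ n) i) ≤ t →
        ∃ a : ℝ, -(b i : EReal) ≤ (a : EReal) ∧ |a - t| ≤ d') ∧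
      ∀ a : ℝ, -(b i : EReal) ≤ (a : EReal) → |a| ≤ R →
        |max a (-(√(n : ℝ) * bet (θ n) i)) - a| ≤ d' := by
    rw [eventually_all]
    exact fun i => eventually_beta_approx
      (fun n => mul_nonneg (Real.sqrt_nonneg _) (hβ0 n i)) (hb i) R hd'
  -- Because `β₀` lies strictly below `βU`, the upper bound is eventually inactive; `max R 0` bounds
  -- the truncated coordinates from above.
  have hβup : ∀ᶠ n : ℕ in atTop, ∀ i,
      ((bet (θ n) i + (√(n : ℝ))⁻¹ * max R 0 : ℝ) : EReal) ≤ βU := by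
    rw [eventually_all]
    intro i
    refine eventually_coe_le_of_tendsto (a := bet θ₀ i) ?_ (hβ₀ i)
    have h1 := ((continuous_apply i).comp continuous_bet).tendsto θ₀ |>.comp hθ
    simpa using h1.add (tendsto_inv_sqrt_natCast.mul_const (max R 0))
  obtain ⟨ρ, hρ, hball⟩ := Metric.mem_nhds_iff.1 (mem_interior_iff_mem_nhds.1 hδ₀)
  have hδ : ∀ᶠ n : ℕ in atTop, ‖del (θ n) - del θ₀‖ < ρ / 2 := by
    have h1 := (continuous_del.tendsto θ₀).comp hθ
    filter_upwards [(Metric.tendsto_nhds.1 h1) (ρ / 2) (by positivity)] with n hn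
    rwa [dist_eq_norm] at hn
  have hr : ∀ᶠ n : ℕ in atTop, (√(n : ℝ))⁻¹ * R < ρ / 2 := by
    have := tendsto_inv_sqrt_natCast.mul_const R
    rw [zero_mul] at this
    exact this.eventually_lt_const (by positivity)
  filter_upwards [hβ, hβup, hδ, hr, eventually_add_mem_ThetaGamma hγ₀ R, eventually_gt_atTop 0]
    with n hβn hβupn hδn hrn hγn hn0
  have hs : 0 < √(n : ℝ) := Real.sqrt_pos.2 (by exact_mod_cast hn0)
  have hgam : ∀ i, gam (θ n) i = γ₀ i := fun i => congrFun (hnull n).2 i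
  constructor
  · rintro h ⟨h1, h2, -⟩
    have hex : ∀ i, ∃ a : ℝ, -(b i : EReal) ≤ (a : EReal) ∧ |a - bet h i| ≤ d' := by
      intro i
      refine (hβn i).1 _ ?_
      have h3 : 0 ≤ bet (θ n) i + (√(n : ℝ))⁻¹ * bet h i := (h2 i).1
      have h4 := mul_nonneg hs.le h3
      rw [mul_add, mul_inv_cancel_left₀ hs.ne'] at h4
      linarith
    choose v hv1 hv2 using hex
    refine ⟨withBet h v, ⟨?_, hv1⟩, ?_, rfl⟩
    · refine mem_LambdaGamma_of_add_mem (inv_pos.2 hs) ?_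
      convert h1 using 1
      ext i
      rw [← hgam i]
      rfl
    · rw [norm_sub_rev]
      exact norm_withBet_sub_le hd.le hv2
  · rintro a ⟨ha1, ha2⟩ haR
    have haR' : ∀ i, |a i| ≤ R := fun i => (PiLp.norm_apply_le a i).trans haR
    -- Only the `β`-part needs truncation, at the exact rescaled lower bound. The `γ`-part is kept,
    -- so the same approximation serves the null hypothesis.
    refine ⟨withBet a fun i => max (bet a i) (-(√(n : ℝ) * bet (θ n) i)), ⟨?_, ?_, ?_⟩, ?_, rfl⟩
    · have := hγn _ ha1 fun i => haR' _
      convert this using 1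
      ext i
      rw [← hgam i]
      rfl
    · intro i
      set t := max (bet a i) (-(√(n : ℝ) * bet (θ n) i))
      change 0 ≤ bet (θ n) i + (√(n : ℝ))⁻¹ * t ∧
        ((bet (θ n) i + (√(n : ℝ))⁻¹ * t : ℝ) : EReal) ≤ βU
      constructor
      · have h1 : -(√(n : ℝ) * bet (θ n) i) ≤ t := le_max_right _ _
        have h2 := mul_le_mul_of_nonneg_left h1 (inv_pos.2 hs).le
        rw [mul_neg, inv_mul_cancel_left₀ hs.ne'] at h2
        linarith
      · refine le_trans (EReal.coe_le_coe_iff.2 ?_) (hβupn i)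
        have h1 : t ≤ max R 0 := max_le_max ((le_abs_self _).trans (haR' _))
          (by have := mul_nonneg hs.le (hβ0 n i); linarith)
        gcongr
    · refine hball ?_
      change del (θ n) + (√(n : ℝ))⁻¹ • del a ∈ _
      rw [Metric.mem_ball, dist_eq_norm]
      calc ‖del (θ n) + (√(n : ℝ))⁻¹ • del a - del θ₀‖
          = ‖(del (θ n) - del θ₀) + (√(n : ℝ))⁻¹ • del a‖ := by congr 1; abel
        _ ≤ ‖del (θ n) - del θ₀‖ + ‖(√(n : ℝ))⁻¹ • del a‖ := norm_add_le _ _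
        _ ≤ ‖del (θ n) - del θ₀‖ + (√(n : ℝ))⁻¹ * R := by
          rw [norm_smul, Real.norm_of_nonneg (inv_pos.2 hs).le]
          gcongr
          exact (norm_del_le a).trans haR
        _ < ρ := by linarith
    · exact norm_withBet_sub_le hd.le fun i => (hβn i).2 _ (ha2 i) (haR' _)

/-- Second-order expansion of the objective function on `Θ`, near points whose `δ`-part is
interior. -/
theorem abs_taylor_two_le_of_hasContLRDeriv2 {ρ : ℝ}
    (hball : Metric.ball (del θ₀) ρ ⊆ interior Θδ) {F : Par dγ dβ dδ → ℝ}
    (hF : HasContLRDeriv2 (Theta s γL γU βU Θδ)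
      {θ ∈ Theta s γL γU βU Θδ | del θ ∈ interior Θδ} F)
    {x y : Par dγ dβ dδ} (hx : x ∈ Theta s γL γU βU Θδ) (hy : y ∈ Theta s γL γU βU Θδ)
    (hxρ : ‖del x - del θ₀‖ < ρ) (hyρ : ‖del y - del θ₀‖ < ρ)
    {A : Matrix (Idx dγ dβ dδ) (Idx dγ dβ dδ) ℝ} {c : ℝ}
    (hc : ∀ z ∈ Theta s γL γU βU Θδ, ‖z - x‖ ≤ ‖y - x‖ →
      ‖hessian (Theta s γL γU βU Θδ) F z - A‖ ≤ c) :
    |F y - F x - inner ℝ (score (Theta s γL γU βU Θδ) F x) (y - x)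
      - (1 / 2) * inner ℝ (y - x) (Matrix.toEuclideanCLM (𝕜 := ℝ) A (y - x))| ≤
      c * ‖y - x‖ ^ 2 := by
  obtain ⟨h1, h2, -, h3, h4⟩ := hF
  set Θ := Theta s γL γU βU Θδ with hΘ
  -- The arbitrary compact `Θδ` is replaced by an open sup-norm cube inside its interior. The region
  -- becomes a box, and derivatives within `Θ` restrict to it.
  let I : Idx dγ dβ dδ → Set ℝ := Sum.elim
    (Sum.elim (fun i => {t | gammaLower s γL i ≤ (t : EReal) ∧ (t : EReal) ≤ γU})
      (fun _ => {t | 0 ≤ t ∧ (t : EReal) ≤ βU}))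
    (fun i => Set.Ioo (del θ₀ i - ρ) (del θ₀ i + ρ))
  have hI : ∀ i, (I i).OrdConnected := by
    rintro ((i | i) | i)
    · refine ⟨fun p hp q hq t ht => ⟨hp.1.trans (EReal.coe_le_coe_iff.2 ht.1),
        (EReal.coe_le_coe_iff.2 ht.2).trans hq.2⟩⟩
    · refine ⟨fun p hp q hq t ht => ⟨hp.1.trans ht.1,
        (EReal.coe_le_coe_iff.2 ht.2).trans hq.2⟩⟩
    · exact Set.ordConnected_Ioo
  have hρ : 0 < ρ := (norm_nonneg _).trans_lt hxρ
  have hBT : euclideanBox I ⊆ {θ ∈ Θ | del θ ∈ interior Θδ} := by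
    intro z hz
    have hz1 : del z ∈ interior Θδ := by
      refine hball ?_
      rw [Metric.mem_ball, dist_pi_lt_iff hρ]
      intro i
      have := hz (.inr i)
      rw [Real.dist_eq, abs_lt]
      exact ⟨by linarith [this.1, show z (.inr i) = del z i from rfl],
        by linarith [this.2, show z (.inr i) = del z i from rfl]⟩
    exact ⟨⟨fun i => hz (.inl (.inl i)), fun i => hz (.inl (.inr i)), interior_subset hz1⟩, hz1⟩
  have hBΘ : euclideanBox I ⊆ Θ := fun z hz => (hBT hz).1
  have hmem : ∀ z ∈ Θ, ‖del z - del θ₀‖ < ρ → z ∈ euclideanBox I := by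
    rintro z ⟨hz1, hz2, -⟩ hzρ ((i | i) | i)
    · exact hz1 i
    · exact hz2 i
    · have := (norm_le_pi_norm (del z - del θ₀) i).trans_lt hzρ
      rw [Real.norm_eq_abs, Pi.sub_apply, abs_lt] at this
      exact ⟨by linarith [this.1, show z (.inr i) = del z i from rfl],
        by linarith [this.2, show z (.inr i) = del z i from rfl]⟩
  have key := abs_taylor_two_le_of_euclideanBox hI (F := F) (G := pderiv Θ F) (K := hessian Θ F)
    (fun i z hz => (h1 z (hBT hz) i).hasLineDerivWithinAt.mono hBΘ)
    (fun i j z hz => (h2 z (hBT hz) i j).hasLineDerivWithinAt.mono hBΘ)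
    (fun i => by
      have h5 : Continuous fun v : Par dγ dβ dδ => v i := by fun_prop
      exact (h5.comp_continuousOn h3).mono hBT)
    (fun i j => (h4 i j).mono hBT) (hmem x hx hxρ) (hmem y hy hyρ)
    (fun z hz hzx => hc z (hBΘ hz) hzx)
  have hinner : inner ℝ (score Θ F x) (y - x) = ∑ i, pderiv Θ F i x * (y - x) i := by
    simp [score, PiLp.inner_apply, mul_comm]
  rw [hinner]
  exact key

end LocalSets

/-! ### Convergence along a sequence of probability measures -/

section Stochastic

variable {Ω : Type*} [MeasurableSpace Ω] {P : ℕ → Measure Ω}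

/-- A sequence that is `o_p(1)` is below a deterministic null sequence with probability tending
to one. -/
theorem IsLittleOpOne.exists_seq [∀ n, IsProbabilityMeasure (P n)] {X : ℕ → Ω → ℝ≥0∞}
    (hX : IsLittleOpOne P X) :
    ∃ ε : ℕ → ℝ, (∀ n, 0 < ε n) ∧ Tendsto ε atTop (𝓝 0) ∧
      Tendsto (fun n => P n {ω | ENNReal.ofReal (ε n) ≤ X n ω}) atTop (𝓝 0) := by
  -- The admissible levels are those that bound their own exceedance probability. Their infimum
  -- tends to zero, and adding `1 / (n + 1)` makes the level positive and leaves an admissible level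
  -- below it.
  let S : ℕ → Set ℝ := fun n =>
    {e | 0 < e ∧ P n {ω | ENNReal.ofReal e ≤ X n ω} ≤ ENNReal.ofReal e}
  have hne : ∀ n, (S n).Nonempty := fun n => ⟨1, one_pos, by simpa using prob_le_one⟩
  have hbdd : ∀ n, BddBelow (S n) := fun n => ⟨0, fun e he => he.1.le⟩
  have hinf : ∀ n, 0 ≤ sInf (S n) := fun n => le_csInf (hne n) fun e he => he.1.le
  have hpos : ∀ n : ℕ, (0 : ℝ) < 1 / (n + 1) := fun n => by positivity
  set ε : ℕ → ℝ := fun n => sInf (S n) + 1 / (n + 1) with hε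
  have hlim : Tendsto ε atTop (𝓝 0) := by
    rw [Metric.tendsto_nhds]
    intro δ hδ
    have h1 := (ENNReal.tendsto_nhds_zero.1 (hX (ENNReal.ofReal (δ / 2)) (by simpa using hδ)))
      (ENNReal.ofReal (δ / 2)) (by simpa using hδ)
    have h2 := (tendsto_one_div_add_atTop_nhds_zero_nat (𝕜 := ℝ)).eventually_lt_const
      (half_pos hδ)
    filter_upwards [h1, h2] with n hn1 hn2
    have h3 : sInf (S n) ≤ δ / 2 := csInf_le (hbdd n) ⟨half_pos hδ, hn1⟩
    rw [Real.dist_eq, sub_zero, abs_of_nonneg (add_nonneg (hinf n) (hpos n).le)]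
    linarith
  refine ⟨ε, fun n => add_pos_of_nonneg_of_pos (hinf n) (hpos n), hlim, ?_⟩
  have hbound : ∀ n, P n {ω | ENNReal.ofReal (ε n) ≤ X n ω} ≤ ENNReal.ofReal (ε n) := by
    intro n
    obtain ⟨e, he, hlt⟩ := exists_lt_of_csInf_lt (hne n) (lt_add_of_pos_right _ (hpos n))
    have h1 : ENNReal.ofReal e ≤ ENNReal.ofReal (ε n) := ENNReal.ofReal_le_ofReal hlt.le
    exact (measure_mono fun ω hω => h1.trans hω).trans (he.2.trans h1)
  have h0 : Tendsto (fun n => ENNReal.ofReal (ε n)) atTop (𝓝 0) := by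
    simpa using ENNReal.tendsto_ofReal hlim
  exact tendsto_of_tendsto_of_tendsto_of_le_of_le tendsto_const_nhds h0 (fun _ => zero_le) hbound

variable [∀ n, IsProbabilityMeasure (P n)] {Ω' : Type*} [MeasurableSpace Ω'] {μ : Measure Ω'}
  [IsProbabilityMeasure μ]

/-- A sequence that converges in distribution is bounded in probability. -/
theorem TendstoInDistribution.exists_eventually_measure_norm_le {E : Type*} [NormedAddCommGroup E]
    [MeasurableSpace E] [BorelSpace E] [CompleteSpace E] [SecondCountableTopology E]
    {X : ℕ → Ω → E} {Z : Ω' → E} (hX : TendstoInDistribution X atTop Z P μ) {r : ℝ≥0∞}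
    (hr : 0 < r) : ∃ M : ℝ, 0 < M ∧ ∀ᶠ n in atTop, P n {ω | M ≤ ‖X n ω‖} ≤ r := by
  have hZ := hX.aemeasurable_limit
  have := Measure.isProbabilityMeasure_map (μ := μ) hZ
  have h1 := tendsto_measure_norm_gt_of_isTightMeasureSet
    (isTightMeasureSet_singleton (μ := μ.map Z))
  simp only [Set.mem_singleton_iff, iSup_iSup_eq_left] at h1
  obtain ⟨M, hM, hM0⟩ := ((h1.eventually_lt_const hr).and (eventually_gt_atTop 0)).exists
  -- Raising `M` by one fits a closed set inside the open tail, so that the portmanteau bound for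
  -- closed sets applies.
  refine ⟨M + 1, by linarith, ?_⟩
  have hclosed : IsClosed {x : E | M + 1 ≤ ‖x‖} := isClosed_le continuous_const continuous_norm
  have h2 := ProbabilityMeasure.limsup_measure_closed_le_of_tendsto hX.tendsto hclosed
  have h3 : (μ.map Z) {x : E | M + 1 ≤ ‖x‖} < r :=
    (measure_mono fun x (hx : M + 1 ≤ ‖x‖) => show M < ‖x‖ by linarith).trans_lt hM
  filter_upwards [eventually_lt_of_limsup_lt (h2.trans_lt h3)] with n hn
  have h4 : (P n).map (X n) {x : E | M + 1 ≤ ‖x‖} < r := hn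
  rw [Measure.map_apply_of_aemeasurable (hX.forall_aemeasurable n) hclosed.measurableSet] at h4
  exact h4.le

/-- **Slutsky's theorem** along a sequence of probability measures. -/
theorem TendstoInDistribution.of_measure_le_norm_sub {E : Type*} [NormedAddCommGroup E]
    [MeasurableSpace E] [BorelSpace E] [SecondCountableTopology E]
    {X Y : ℕ → Ω → E} {Z : Ω' → E} (hX : TendstoInDistribution X atTop Z P μ)
    (hY : ∀ n, AEMeasurable (Y n) (P n))
    (hXY : ∀ ε : ℝ, 0 < ε → Tendsto (fun n => P n {ω | ε ≤ ‖Y n ω - X n ω‖}) atTop (𝓝 0)) :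
    TendstoInDistribution Y atTop Z P μ := by
  -- On the product space the `n`-th pair reads the `n`-th coordinate. This keeps the law of each `X
  -- n` and `Y n` and the exceedance bounds for their difference, while all variables live under one
  -- measure.
  let Q : Measure (ℕ → Ω) := Measure.infinitePi P
  have hpres : ∀ n, MeasurePreserving (Function.eval n) Q (P n) :=
    fun n => measurePreserving_eval_infinitePi P n
  have hmap : ∀ (U : ℕ → Ω → E), (∀ n, AEMeasurable (U n) (P n)) → ∀ n,
      AEMeasurable (fun x : ℕ → Ω => U n (x n)) Q ∧
        Q.map (fun x : ℕ → Ω => U n (x n)) = (P n).map (U n) := by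
    intro U hU n
    refine ⟨(hU n).comp_quasiMeasurePreserving (hpres n).quasiMeasurePreserving, ?_⟩
    have h1 : AEMeasurable (U n) (Q.map (Function.eval n)) := by
      rw [(hpres n).map_eq]
      exact hU n
    have h2 := AEMeasurable.map_map_of_aemeasurable h1 (hpres n).aemeasurable
    rw [(hpres n).map_eq] at h2
    exact h2.symm
  have hXm := hmap X hX.forall_aemeasurable
  have hYm := hmap Y hY
  have hX' : TendstoInDistribution (fun n (x : ℕ → Ω) => X n (x n)) atTop Z (fun _ => Q) μ := by
    refine ⟨fun n => (hXm n).1, hX.aemeasurable_limit, ?_⟩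
    refine hX.tendsto.congr fun n => ?_
    exact Subtype.ext (hXm n).2.symm
  have hY' : TendstoInDistribution (fun n (x : ℕ → Ω) => Y n (x n)) atTop Z (fun _ => Q) μ := by
    refine tendstoInDistribution_of_tendstoInMeasure_sub _ _ hX' ?_ fun n => (hYm n).1
    rw [tendstoInMeasure_iff_norm]
    intro ε hε
    refine tendsto_of_tendsto_of_tendsto_of_le_of_le tendsto_const_nhds (hXY ε hε)
      (fun _ => zero_le) fun n => ?_
    have := (hpres n).measure_preimage_le {ω | ε ≤ ‖Y n ω - X n ω‖}
    simpa using this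
  refine ⟨hY, hX.aemeasurable_limit, ?_⟩
  refine hY'.tendsto.congr fun n => ?_
  exact Subtype.ext (hYm n).2

/-- The image of a centered Gaussian distribution under a linear map. -/
theorem map_toEuclideanCLM_multivariateGaussian_zero {ι : Type*} [Fintype ι] [DecidableEq ι]
    {S : Matrix ι ι ℝ} (hS : S.PosSemidef) (B : Matrix ι ι ℝ) :
    (multivariateGaussian 0 S).map (Matrix.toEuclideanCLM (𝕜 := ℝ) B) =
      multivariateGaussian 0 (B * S * Bᵀ) := by
  have hBS : (B * S * Bᵀ).PosSemidef := hS.mul_mul_conjTranspose_same B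
  apply IsGaussian.ext
  · simp only [id_eq, integral_id_multivariateGaussian]
    rw [ContinuousLinearMap.integral_id_map IsGaussian.integrable_id,
      integral_id_multivariateGaussian, map_zero]
  · ext x y
    rw [covarianceBilin_map IsGaussian.memLp_two_id, covarianceBilin_multivariateGaussian hS,
      covarianceBilin_multivariateGaussian hBS]
    have hadj : ∀ v : EuclideanSpace ℝ ι,
        ((Matrix.toEuclideanCLM (𝕜 := ℝ) B).adjoint v : ι → ℝ) = Bᵀ *ᵥ v := by
      intro v
      rw [← ContinuousLinearMap.star_eq_adjoint, ← map_star]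
      rfl
    rw [hadj, hadj, ← Matrix.mulVec_mulVec, ← Matrix.mulVec_mulVec, Matrix.dotProduct_mulVec x B,
      ← Matrix.mulVec_transpose]

end Stochastic

/-! ### The likelihood ratio statistic -/

section LikelihoodRatio

variable {s : ℕ} {γL γU βU : EReal} {γ₀ : Fin dγ → ℝ} {Θδ : Set (Fin dδ → ℝ)}
  {θ₀ : Par dγ dβ dδ} {Ω₀ : Matrix (Idx dγ dβ dδ) (Idx dγ dβ dδ) ℝ}

theorem enorm_lt_ofReal_iff {E : Type*} [SeminormedAddCommGroup E] {x : E} {r : ℝ} :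
    ‖x‖ₑ < ENNReal.ofReal r ↔ ‖x‖ < r := by
  rw [← ofReal_norm, ENNReal.ofReal_lt_ofReal_iff_of_nonneg (norm_nonneg _)]

/-- The rescaled objective function is close to its quadratic approximation. -/
theorem abs_rescaled_sub_quadGain_le {ρ : ℝ} (hball : Metric.ball (del θ₀) ρ ⊆ interior Θδ)
    {F : Par dγ dβ dδ → ℝ}
    (hF : HasContLRDeriv2 (Theta s γL γU βU Θδ)
      {θ ∈ Theta s γL γU βU Θδ | del θ ∈ interior Θδ} F)
    {x h : Par dγ dβ dδ} (hx : x ∈ Theta s γL γU βU Θδ) {n : ℕ} (hn : 0 < n) {ε η : ℝ}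
    (hxρ : ‖del x - del θ₀‖ < ρ / 2) (hε : ε < ρ / 2)
    (hy : x + (√(n : ℝ))⁻¹ • h ∈ Theta s γL γU βU Θδ) (hh : ‖h‖ ≤ √(n : ℝ) * ε)
    (hsup : (⨆ θ ∈ {θ ∈ Theta s γL γU βU Θδ | ‖θ - x‖ ≤ ε},
      ‖(n : ℝ)⁻¹ • hessian (Theta s γL γU βU Θδ) F θ
        - (n : ℝ)⁻¹ • hessian (Theta s γL γU βU Θδ) F x‖ₑ) < ENNReal.ofReal η)
    (hhess : ‖(n : ℝ)⁻¹ • hessian (Theta s γL γU βU Θδ) F x - (-Ω₀)‖ₑ < ENNReal.ofReal η) :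
    |2 * (F (x + (√(n : ℝ))⁻¹ • h) - F x)
      - quadGain (Matrix.toEuclideanCLM (𝕜 := ℝ) Ω₀)
          ((√(n : ℝ))⁻¹ • score (Theta s γL γU βU Θδ) F x) h| ≤ 4 * η * ‖h‖ ^ 2 := by
  set Θ := Theta s γL γU βU Θδ with hΘ
  have hn' : (0 : ℝ) < n := by exact_mod_cast hn
  have hs : 0 < √(n : ℝ) := Real.sqrt_pos.2 hn'
  set r := (√(n : ℝ))⁻¹ with hr
  have hr0 : 0 < r := inv_pos.2 hs
  have hrn : n * r ^ 2 = 1 := by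
    rw [hr, inv_pow, Real.sq_sqrt hn'.le]
    exact mul_inv_cancel₀ hn'.ne'
  set y := x + r • h with hydef
  have hyx : y - x = r • h := by simp [hydef]
  have hnyx : ‖y - x‖ ≤ ε := by
    rw [hyx, norm_smul, Real.norm_of_nonneg hr0.le, hr, inv_mul_le_iff₀ hs]
    exact hh
  have hyρ : ‖del y - del θ₀‖ < ρ := by
    have h1 : ‖del y - del x‖ ≤ ‖y - x‖ := norm_del_le (y - x)
    calc ‖del y - del θ₀‖ ≤ ‖del y - del x‖ + ‖del x - del θ₀‖ :=
          norm_sub_le_norm_sub_add_norm_sub _ _ _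
      _ < ρ := by linarith
  -- The Hessian at `z` is compared with the one at `x`, and that one with `-n Ω₀`; each normalized
  -- error is below `η`. Doubling the objective turns `2 η` into the final `4 η`.
  have hc : ∀ z ∈ Θ, ‖z - x‖ ≤ ‖y - x‖ → ‖hessian Θ F z - (-(n : ℝ)) • Ω₀‖ ≤ n * (2 * η) := by
    intro z hz hzx
    have h1 := (le_iSup₂ (f := fun θ (_ : θ ∈ {θ ∈ Θ | ‖θ - x‖ ≤ ε}) =>
      ‖(n : ℝ)⁻¹ • hessian Θ F θ - (n : ℝ)⁻¹ • hessian Θ F x‖ₑ) z ⟨hz, hzx.trans hnyx⟩).trans_lt hsup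
    rw [enorm_lt_ofReal_iff] at h1 hhess
    have h2 : hessian Θ F z - (-(n : ℝ)) • Ω₀ = (n : ℝ) •
        (((n : ℝ)⁻¹ • hessian Θ F z - (n : ℝ)⁻¹ • hessian Θ F x) +
          ((n : ℝ)⁻¹ • hessian Θ F x - (-Ω₀))) := by
      rw [sub_add_sub_cancel, smul_sub, smul_smul, mul_inv_cancel₀ hn'.ne', one_smul, neg_smul,
        smul_neg]
    rw [h2, norm_smul, Real.norm_of_nonneg hn'.le]
    refine mul_le_mul_of_nonneg_left ((norm_add_le _ _).trans ?_) hn'.le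
    linarith
  have key := abs_taylor_two_le_of_hasContLRDeriv2 hball hF hx hy
    (by linarith [norm_nonneg (del x - del θ₀)]) hyρ hc
  rw [hyx, map_smul, map_smul, smul_apply, norm_smul,
    Real.norm_of_nonneg hr0.le] at key
  simp only [real_inner_smul_left, real_inner_smul_right] at key
  simp only [quadGain, real_inner_smul_left]
  set a := inner ℝ (score Θ F x) h
  set q := inner ℝ h (Matrix.toEuclideanCLM (𝕜 := ℝ) Ω₀ h)
  have e1 : 2 * (F y - F x) - (2 * (r * a) - q) = 2 * (F y - F x - r * a -
      1 / 2 * (r * (r * (-(n : ℝ) * q)))) := by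
    linear_combination (-q) * hrn
  rw [e1, abs_mul, abs_two]
  calc 2 * |F y - F x - r * a - 1 / 2 * (r * (r * (-(n : ℝ) * q)))|
      ≤ 2 * (n * (2 * η) * (r * ‖h‖) ^ 2) := by
        refine mul_le_mul_of_nonneg_left (le_trans (le_of_eq ?_) key) two_pos.le
        congr 1
        ring
    _ = 4 * η * ‖h‖ ^ 2 * (n * r ^ 2) := by ring
    _ = 4 * η * ‖h‖ ^ 2 := by rw [hrn, mul_one]

theorem stack_zero_LambdaBeta_subset {b : Fin dβ → ℝ≥0∞} :
    cylinderOver (dδ := dδ) (stack {0} (LambdaBeta b)) ⊆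
      cylinderOver (stack (LambdaGamma s γL γU γ₀) (LambdaBeta b)) := by
  rintro h ⟨h1, h2⟩
  refine ⟨?_, h2⟩
  rw [Set.mem_singleton_iff.1 h1]
  exact zero_mem_LambdaGamma

theorem zero_mem_cylinderOver_stack (b : Fin dβ → ℝ≥0∞) :
    (0 : Par dγ dβ dδ) ∈ cylinderOver (stack {0} (LambdaBeta b)) := by
  refine ⟨rfl, fun i => ?_⟩
  rw [neg_coe_le_coe_iff]
  intro _
  simp

/-- `L_∞(b, b)` is a difference of two maximal gains. -/
theorem Linfty_eq (hΩ : Ω₀.PosDef) (b : Fin dβ → ℝ≥0∞) (z : Par dγ dβ dδ) :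
    Linfty Ω₀ (LambdaGamma s γL γU γ₀) b b z =
      maxGain (Matrix.toEuclideanCLM (𝕜 := ℝ) Ω₀)
          (cylinderOver (stack (LambdaGamma s γL γU γ₀) (LambdaBeta b)))
          (Matrix.toEuclideanCLM (𝕜 := ℝ) Ω₀ z) -
        maxGain (Matrix.toEuclideanCLM (𝕜 := ℝ) Ω₀) (cylinderOver (stack {0} (LambdaBeta b)))
          (Matrix.toEuclideanCLM (𝕜 := ℝ) Ω₀ z) := by
  have h0 := zero_mem_cylinderOver_stack (dγ := dγ) (dδ := dδ) b
  have h1 := stack_zero_LambdaBeta_subset (s := s) (γL := γL) (γU := γU) (γ₀ := γ₀) h0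
  rw [Linfty, sInf_quadQ_eq hΩ z (V := stack {0} (LambdaBeta b))
      ⟨fun i => (0 : Par dγ dβ dδ) (.inl i), h0⟩,
    sInf_quadQ_eq hΩ z (V := stack (LambdaGamma s γL γU γ₀) (LambdaBeta b))
      ⟨fun i => (0 : Par dγ dβ dδ) (.inl i), h1⟩]
  ring

/-- The statistic is asymptotically equivalent to a difference of maximal gains, evaluated at the
normalized score. -/
theorem tendsto_measure_le_LR_sub {Ω : Type*} [MeasurableSpace Ω] {P : ℕ → Measure Ω}
    [∀ n, IsProbabilityMeasure (P n)] {L : ℕ → Ω → Par dγ dβ dδ → ℝ} {θ : ℕ → Par dγ dβ dδ}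
    {b : Fin dβ → ℝ≥0∞}
    (hnull : ∀ n, θ n ∈ ThetaNull (Theta s γL γU βU Θδ) γ₀) (hθ : Tendsto θ atTop (𝓝 θ₀))
    (hb : ∀ i, Tendsto (fun n : ℕ => ENNReal.ofReal (√(n : ℝ) * bet (θ n) i)) atTop (𝓝 (b i)))
    (hβ₀ : ∀ i, (bet θ₀ i : EReal) < βU) (hδ₀ : del θ₀ ∈ interior Θδ)
    {θhat θtilde : ℕ → Ω → Par dγ dβ dδ}
    (hhat : ∀ n, 1 ≤ n → ∀ᵐ ω ∂(P n), θhat n ω ∈ Theta s γL γU βU Θδ ∧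
      IsMaxOn (L n ω) (Theta s γL γU βU Θδ) (θhat n ω))
    (htilde : ∀ n, 1 ≤ n → ∀ᵐ ω ∂(P n), θtilde n ω ∈ ThetaNull (Theta s γL γU βU Θδ) γ₀ ∧
      IsMaxOn (L n ω) (ThetaNull (Theta s γL γU βU Θδ) γ₀) (θtilde n ω))
    (hΩ₀ : Ω₀.PosDef) {S₀ : Matrix (Idx dγ dβ dδ) (Idx dγ dβ dδ) ℝ}
    (h1 : Consistency P θhat θtilde θ)
    (h2 : Smoothness P L (Theta s γL γU βU Θδ)
      {θ ∈ Theta s γL γU βU Θδ | del θ ∈ interior Θδ} θ)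
    (h3 : HessianLimit P L (Theta s γL γU βU Θδ) θ Ω₀)
    (h4 : ScoreLimit P L (Theta s γL γU βU Θδ) θ S₀) {ε : ℝ} (hε : 0 < ε) :
    Tendsto (fun n => P n {ω | ε ≤ ‖2 * (L n ω (θhat n ω) - L n ω (θtilde n ω)) -
      (maxGain (Matrix.toEuclideanCLM (𝕜 := ℝ) Ω₀)
          (cylinderOver (stack (LambdaGamma s γL γU γ₀) (LambdaBeta b)))
          ((√(n : ℝ))⁻¹ • score (Theta s γL γU βU Θδ) (L n ω) (θ n)) -
        maxGain (Matrix.toEuclideanCLM (𝕜 := ℝ) Ω₀) (cylinderOver (stack {0} (LambdaBeta b)))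
          ((√(n : ℝ))⁻¹ • score (Theta s γL γU βU Θδ) (L n ω) (θ n)))‖}) atTop (𝓝 0) := by
  set Θ := Theta (dγ := dγ) s γL γU βU Θδ with hΘ
  set A := Matrix.toEuclideanCLM (𝕜 := ℝ) Ω₀
  set S : Set (Par dγ dβ dδ) := cylinderOver (stack (LambdaGamma s γL γU γ₀) (LambdaBeta b))
  set T : Set (Par dγ dβ dδ) := cylinderOver (stack {0} (LambdaBeta b))
  obtain ⟨c, hc, hA⟩ := hΩ₀.exists_mul_norm_sq_le
  obtain ⟨ε₁, hε₁, hε₁lim, hε₁P⟩ := h1.1.exists_seq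
  obtain ⟨ε₂, hε₂, hε₂lim, hε₂P⟩ := h1.2.exists_seq
  obtain ⟨hsmooth, hsup⟩ := h2
  -- The radius dominates both consistency rates. Its third term `n^(-1/4)` makes `√n e_n` diverge,
  -- so the rescaled neighbourhood eventually contains the ball of radius `R`.
  set e : ℕ → ℝ := fun n => ε₁ n + ε₂ n + √(√(n : ℝ))⁻¹ with he
  have helim : Tendsto e atTop (𝓝 0) := by
    have h5 : Tendsto (fun n : ℕ => √(√(n : ℝ))⁻¹) atTop (𝓝 0) := by
      have := (Real.continuous_sqrt.tendsto 0).comp tendsto_inv_sqrt_natCast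
      simpa [Function.comp_def] using this
    simpa [he] using (hε₁lim.add hε₂lim).add h5
  rw [ENNReal.tendsto_nhds_zero]
  intro r hr
  -- One fifth for each exceptional event: large score, either estimator far from `θ_n`, Hessian
  -- oscillation, Hessian far from its limit.
  have hr5 : 0 < r / 5 := ENNReal.div_pos hr.ne' (by simp)
  obtain ⟨M, hM, hMP⟩ := TendstoInDistribution.exists_eventually_measure_norm_le h4 hr5
  obtain ⟨η, hη, d, hd, R, hR, hmain⟩ :=
    exists_abs_sub_maxGain_le hc hA hM.le (show (0 : ℝ) < ε / 3 by positivity)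
  obtain ⟨ρ, hρ, hball⟩ := Metric.isOpen_iff.1 isOpen_interior _ hδ₀
  have hη4 : 0 < ENNReal.ofReal (η / 4) := by simpa using hη
  have hδ : ∀ᶠ n : ℕ in atTop, ‖del (θ n) - del θ₀‖ < ρ / 2 := by
    have h1 := (continuous_del.tendsto θ₀).comp hθ
    filter_upwards [(Metric.tendsto_nhds.1 h1) (ρ / 2) (by positivity)] with n hn
    rwa [dist_eq_norm] at hn
  have hRe : ∀ᶠ n : ℕ in atTop, R ≤ √(n : ℝ) * e n := by
    have h5 : Tendsto (fun n : ℕ => √(√(n : ℝ))) atTop atTop :=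
      Real.tendsto_sqrt_atTop.comp (Real.tendsto_sqrt_atTop.comp tendsto_natCast_atTop_atTop)
    filter_upwards [h5.eventually_ge_atTop R, eventually_gt_atTop 0] with n hn hn0
    have hs : 0 < √(n : ℝ) := Real.sqrt_pos.2 (by exact_mod_cast hn0)
    have h6 : √(n : ℝ) * √(√(n : ℝ))⁻¹ = √(√(n : ℝ)) := by
      rw [Real.sqrt_inv]
      nth_rewrite 1 [← Real.mul_self_sqrt hs.le]
      rw [mul_assoc, mul_inv_cancel₀ (Real.sqrt_pos.2 hs).ne', mul_one]
    have h7 : √(√(n : ℝ))⁻¹ ≤ e n := by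
      have := hε₁ n
      have := hε₂ n
      simp only [he]
      linarith
    calc R ≤ √(n : ℝ) * √(√(n : ℝ))⁻¹ := hn.trans h6.ge
      _ ≤ √(n : ℝ) * e n := by gcongr
  filter_upwards [hMP, hδ, hRe, helim.eventually_lt_const (half_pos hρ),
    (ENNReal.tendsto_nhds_zero.1 hε₁P) _ hr5, (ENNReal.tendsto_nhds_zero.1 hε₂P) _ hr5,
    (ENNReal.tendsto_nhds_zero.1 (hsup e helim _ hη4)) _ hr5,
    (ENNReal.tendsto_nhds_zero.1 (h3 _ hη4)) _ hr5,
    eventually_local_approx hnull hθ hb hβ₀ hδ₀ R hd, eventually_gt_atTop 0]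
    with n hMn hδn hRn hen hP1 hP2 hP3 hP4 hloc hn0
  have hn' : (0 : ℝ) < n := by exact_mod_cast hn0
  have hs : 0 < √(n : ℝ) := Real.sqrt_pos.2 hn'
  set E₀ : Set Ω := {ω | M ≤ ‖(√(n : ℝ))⁻¹ • score Θ (L n ω) (θ n)‖}
  set E₁ : Set Ω := {ω | ENNReal.ofReal (ε₁ n) ≤ ‖θhat n ω - θ n‖ₑ}
  set E₂ : Set Ω := {ω | ENNReal.ofReal (ε₂ n) ≤ ‖θtilde n ω - θ n‖ₑ}
  set E₃ : Set Ω := {ω | ENNReal.ofReal (η / 4) ≤ ⨆ ϑ ∈ {ϑ ∈ Θ | ‖ϑ - θ n‖ ≤ e n},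
    ‖(n : ℝ)⁻¹ • hessian Θ (L n ω) ϑ - (n : ℝ)⁻¹ • hessian Θ (L n ω) (θ n)‖ₑ}
  set E₄ : Set Ω := {ω | ENNReal.ofReal (η / 4) ≤
    ‖(n : ℝ)⁻¹ • hessian Θ (L n ω) (θ n) - (-Ω₀)‖ₑ}
  have hrescale : ∀ ϑ : Par dγ dβ dδ, θ n + (√(n : ℝ))⁻¹ • (√(n : ℝ) • (ϑ - θ n)) = ϑ := by
    intro ϑ
    rw [smul_smul, inv_mul_cancel₀ hs.ne', one_smul, add_sub_cancel]
  have hnorm : ∀ ϑ : Par dγ dβ dδ, ‖ϑ - θ n‖ ≤ e n → ‖√(n : ℝ) • (ϑ - θ n)‖ ≤ √(n : ℝ) * e n := by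
    intro ϑ h
    rw [norm_smul, Real.norm_of_nonneg hs.le]
    gcongr
  have hsq : 0 ≤ √(√(n : ℝ))⁻¹ := Real.sqrt_nonneg _
  have hgamn : gam (θ n) = γ₀ := (hnull n).2
  -- Off the five events the argument is deterministic: each of the two maxima is within `ε / 3` of
  -- its maximal gain, so the difference is off by less than `ε`.
  have hcover : ∀ᵐ ω ∂(P n), ω ∈ {ω | ε ≤ ‖2 * (L n ω (θhat n ω) - L n ω (θtilde n ω)) -
      (maxGain A S ((√(n : ℝ))⁻¹ • score Θ (L n ω) (θ n)) -
        maxGain A T ((√(n : ℝ))⁻¹ • score Θ (L n ω) (θ n)))‖} →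
      ω ∈ E₀ ∪ (E₁ ∪ (E₂ ∪ (E₃ ∪ E₄))) := by
    filter_upwards [hhat n hn0, htilde n hn0, hsmooth n hn0] with ω hωhat hωtilde hωF hω
    by_contra hnot
    simp only [Set.mem_union, not_or] at hnot
    obtain ⟨n0, n1, n2, n3, n4⟩ := hnot
    set g := (√(n : ℝ))⁻¹ • score Θ (L n ω) (θ n)
    replace n0 : ‖g‖ < M := lt_of_not_ge n0
    replace n1 : ‖θhat n ω - θ n‖ < ε₁ n := enorm_lt_ofReal_iff.1 (lt_of_not_ge n1)
    replace n2 : ‖θtilde n ω - θ n‖ < ε₂ n := enorm_lt_ofReal_iff.1 (lt_of_not_ge n2)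
    simp only [E₃, Set.mem_ofPred_eq, not_le] at n3
    simp only [E₄, Set.mem_ofPred_eq, not_le] at n4
    set ℓ : Par dγ dβ dδ → ℝ :=
      fun h => 2 * (L n ω (θ n + (√(n : ℝ))⁻¹ • h) - L n ω (θ n)) with hℓdef
    have hℓ : ∀ h, θ n + (√(n : ℝ))⁻¹ • h ∈ Θ → ‖h‖ ≤ √(n : ℝ) * e n →
        |ℓ h - quadGain A g h| ≤ η * ‖h‖ ^ 2 := by
      intro h hh hhn
      have := abs_rescaled_sub_quadGain_le hball hωF (hnull n).1 hn0 hδn hen hh hhn n3 n4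
      rwa [mul_div_cancel₀ _ (four_ne_zero)] at this
    have hfull : |ℓ (√(n : ℝ) • (θhat n ω - θ n)) - maxGain A S g| ≤ ε / 3 := by
      refine hmain S {h | θ n + (√(n : ℝ))⁻¹ • h ∈ Θ} g ℓ (√(n : ℝ) * e n) _
        (stack_zero_LambdaBeta_subset (zero_mem_cylinderOver_stack b)) ?_ ?_ ?_ n0.le hRn
        (fun h hh hhn => hℓ h hh hhn) ?_ (hnorm _ ?_) ?_
      · simpa using (hnull n).1
      · intro h hh _
        obtain ⟨a, ha, had, -⟩ := hloc.1 h hh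
        exact ⟨a, ha, had⟩
      · intro a ha haR
        obtain ⟨h, hh, hhd, -⟩ := hloc.2 a ha haR
        exact ⟨h, hh, hhd⟩
      · simpa only [Set.mem_ofPred_eq, hrescale] using hωhat.1
      · have := hε₂ n
        simp only [he]
        linarith
      · intro h hh
        have := hωhat.2 hh
        simp only [hℓdef, hrescale]
        have h9 : L n ω (θ n + (√(n : ℝ))⁻¹ • h) ≤ L n ω (θhat n ω) := this
        linarith
    have hrestr : |ℓ (√(n : ℝ) • (θtilde n ω - θ n)) - maxGain A T g| ≤ ε / 3 := by
      -- In local coordinates the null hypothesis reads `gam h = 0`, a condition preserved by the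
      -- approximating points since they share the `γ`-part.
      have hgamadd : ∀ h : Par dγ dβ dδ, gam (θ n + (√(n : ℝ))⁻¹ • h) = γ₀ ↔ gam h = 0 := by
        intro h
        have : gam (θ n + (√(n : ℝ))⁻¹ • h) = γ₀ + (√(n : ℝ))⁻¹ • gam h := by
          rw [← hgamn]; rfl
        rw [this, add_eq_left, smul_eq_zero, or_iff_right (inv_pos.2 hs).ne']
      refine hmain T {h | θ n + (√(n : ℝ))⁻¹ • h ∈ ThetaNull Θ γ₀} g ℓ (√(n : ℝ) * e n) _
        (zero_mem_cylinderOver_stack b) ?_ ?_ ?_ n0.le hRn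
        (fun h hh hhn => hℓ h hh.1 hhn) ?_ (hnorm _ ?_) ?_
      · simpa using hnull n
      · intro h hh _
        obtain ⟨a, ha, had, hag⟩ := hloc.1 h hh.1
        exact ⟨a, ⟨hag.trans ((hgamadd h).1 hh.2), ha.2⟩, had⟩
      · intro a ha haR
        obtain ⟨h, hh, hhd, hhg⟩ := hloc.2 a (stack_zero_LambdaBeta_subset ha) haR
        exact ⟨h, ⟨hh, (hgamadd h).2 (hhg.trans ha.1)⟩, hhd⟩
      · simpa only [Set.mem_ofPred_eq, hrescale] using hωtilde.1
      · have := hε₁ n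
        simp only [he]
        linarith
      · intro h hh
        have := hωtilde.2 hh
        simp only [hℓdef, hrescale]
        have h9 : L n ω (θ n + (√(n : ℝ))⁻¹ • h) ≤ L n ω (θtilde n ω) := this
        linarith
    simp only [hℓdef, hrescale] at hfull hrestr
    have hω' : ε ≤ |2 * (L n ω (θhat n ω) - L n ω (θtilde n ω)) -
      (maxGain A S g - maxGain A T g)| := hω
    rw [abs_le] at hfull hrestr
    rcases le_abs.1 hω' with h | h <;> linarith
  calc _ ≤ P n (E₀ ∪ (E₁ ∪ (E₂ ∪ (E₃ ∪ E₄)))) := measure_mono_ae hcover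
    _ ≤ r / 5 + (r / 5 + (r / 5 + (r / 5 + r / 5))) := by
      refine (measure_union_le _ _).trans (add_le_add hMn ?_)
      refine (measure_union_le _ _).trans (add_le_add hP1 ?_)
      refine (measure_union_le _ _).trans (add_le_add hP2 ?_)
      exact (measure_union_le _ _).trans (add_le_add hP3 hP4)
    _ = r := by
      have : r / 5 + (r / 5 + (r / 5 + (r / 5 + r / 5))) = 5 * (r / 5) := by ring
      rw [this, ENNReal.mul_div_cancel (by simp) (by simp)]

end LikelihoodRatio

end

theorem lemma1
    {dγ dβ dδ : ℕ}
    -- the parameter space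
    (s : ℕ) (hs : s ≤ dγ)
    (γL γU βU : EReal) (hγL : γL < 0) (hγU : 0 < γU) (hβU : 0 < βU)
    (Θδ : Set (Fin dδ → ℝ)) (hΘδ : IsCompact Θδ)
    (Θ : Set (Par dγ dβ dδ)) (hΘ : Θ = Theta s γL γU βU Θδ)
    {Φ : Type*} [MetricSpace Φ] [CompactSpace Φ] (Φset : Par dγ dβ dδ → Set Φ)
    -- the data, their laws, and the objective function
    {Ω : Type*} [MeasurableSpace Ω]
    (P : Par dγ dβ dδ × Φ → Measure Ω) [∀ ψ, IsProbabilityMeasure (P ψ)]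
    {𝒲 : Type*} [MeasurableSpace 𝒲] (W : ℕ → Ω → 𝒲) (hW : ∀ t, Measurable (W t))
    (f : (n : ℕ) → (Fin n → 𝒲) → Par dγ dβ dδ → ℝ)
    (L : ℕ → Ω → Par dγ dβ dδ → ℝ)
    (hL : ∀ n ω θ, L n ω θ = f n (fun t => W t ω) θ)
    -- the drifting sequence, along which the null hypothesis holds
    (γ₀ : Fin dγ → ℝ)
    (ψ : ℕ → Par dγ dβ dδ × Φ) (ψ₀ : Par dγ dβ dδ × Φ)
    (hψ : ∀ n, ψ n ∈ Psi Θ Φset) (hnull : ∀ n, (ψ n).1 ∈ ThetaNull Θ γ₀)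
    (hlim : Tendsto ψ atTop (𝓝 ψ₀))
    (b : Fin dβ → ℝ≥0∞)
    (hb : ∀ i, Tendsto (fun n : ℕ => ENNReal.ofReal (√(n : ℝ) * bet (ψ n).1 i)) atTop (𝓝 (b i)))
    (hβ₀ : ∀ i, (bet ψ₀.1 i : EReal) < βU)
    (hδ₀ : del ψ₀.1 ∈ interior Θδ)
    -- the unrestricted and the restricted estimator, and the LR statistic
    (θhat θtilde : ℕ → Ω → Par dγ dβ dδ)
    (hhat : ∀ n, 1 ≤ n → ∀ᵐ ω ∂(P (ψ n)), θhat n ω ∈ Θ ∧ IsMaxOn (L n ω) Θ (θhat n ω))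
    (htilde : ∀ n, 1 ≤ n → ∀ᵐ ω ∂(P (ψ n)), θtilde n ω ∈ ThetaNull Θ γ₀ ∧
      IsMaxOn (L n ω) (ThetaNull Θ γ₀) (θtilde n ω))
    (LR : ℕ → Ω → ℝ)
    (hLR : ∀ n ω, LR n ω = 2 * (L n ω (θhat n ω) - L n ω (θtilde n ω)))
    (hLRmeas : ∀ n, AEMeasurable (LR n) (P (ψ n)))
    -- the four conditions
    (κ : ℝ) (hκ : 0 < κ)
    (Ω₀ S₀ : Matrix (Idx dγ dβ dδ) (Idx dγ dβ dδ) ℝ)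
    (hΩ₀ : Ω₀ ∈ Upsilon κ) (hS₀ : S₀ ∈ Upsilon κ)
    (h1 : Consistency (fun n => P (ψ n)) θhat θtilde (fun n => (ψ n).1))
    (h2 : Smoothness (fun n => P (ψ n)) L Θ {θ ∈ Θ | del θ ∈ interior Θδ} (fun n => (ψ n).1))
    (h3 : HessianLimit (fun n => P (ψ n)) L Θ (fun n => (ψ n).1) Ω₀)
    (h4 : ScoreLimit (fun n => P (ψ n)) L Θ (fun n => (ψ n).1) S₀) :
    SetConverges
      (fun n : ℕ => (fun g => √(n : ℝ) • (g - γ₀)) '' ThetaGamma dγ s γL γU)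
      (LambdaGamma s γL γU γ₀) ∧
    TendstoInDistribution LR atTop
      (Linfty Ω₀ (LambdaGamma s γL γU γ₀) b b)
      (fun n => P (ψ n)) (multivariateGaussian 0 (Ω₀⁻¹ * S₀ * Ω₀⁻¹)) := by
  subst hΘ
  have hΩ := hΩ₀.1
  have hγ₀ : γ₀ ∈ ThetaGamma dγ s γL γU := (hnull 0).2 ▸ (hnull 0).1.1
  refine ⟨setConverges_ThetaGamma hγ₀, ?_⟩
  have hθ : Tendsto (fun n => (ψ n).1) atTop (𝓝 ψ₀.1) := (continuous_fst.tendsto ψ₀).comp hlim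
  obtain ⟨c, hc, hA⟩ := hΩ.exists_mul_norm_sq_le
  set A := Matrix.toEuclideanCLM (𝕜 := ℝ) Ω₀ with hAdef
  set D : Par dγ dβ dδ → ℝ := fun g =>
    maxGain A (cylinderOver (stack (LambdaGamma s γL γU γ₀) (LambdaBeta b))) g -
      maxGain A (cylinderOver (stack {0} (LambdaBeta b))) g with hD
  have hDc : Continuous D :=
    (continuous_maxGain hc hA
      ⟨0, stack_zero_LambdaBeta_subset (zero_mem_cylinderOver_stack b)⟩).sub
      (continuous_maxGain hc hA ⟨0, zero_mem_cylinderOver_stack b⟩)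
  have hLD : Linfty Ω₀ (LambdaGamma s γL γU γ₀) b b = D ∘ A := funext fun z => Linfty_eq hΩ b z
  have hlimit : TendstoInDistribution LR atTop (D ∘ id) (fun n => P (ψ n))
      (multivariateGaussian 0 S₀) := by
    refine TendstoInDistribution.of_measure_le_norm_sub (h4.continuous_comp hDc) hLRmeas ?_
    intro ε hε
    simp only [hLR]
    exact tendsto_measure_le_LR_sub hnull hθ hb hβ₀ hδ₀ hhat htilde hΩ h1 h2 h3 h4 hε
  -- The sandwich covariance collapses: `Ω₀ (Ω₀⁻¹ Σ₀ Ω₀⁻¹) Ω₀ = Σ₀`.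
  have hgauss : (multivariateGaussian 0 (Ω₀⁻¹ * S₀ * Ω₀⁻¹)).map A = multivariateGaussian 0 S₀ := by
    have hsymm : Ω₀ᵀ = Ω₀ := hΩ.isHermitian.eq
    have hdet : IsUnit Ω₀.det := (Matrix.isUnit_iff_isUnit_det _).1 hΩ.isUnit
    have hpsd : (Ω₀⁻¹ * S₀ * Ω₀⁻¹).PosSemidef := by
      have := hS₀.1.posSemidef.mul_mul_conjTranspose_same Ω₀⁻¹
      rwa [hΩ.inv.isHermitian.eq] at this
    rw [hAdef, map_toEuclideanCLM_multivariateGaussian_zero hpsd, hsymm]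
    congr 1
    rw [Matrix.mul_assoc, Matrix.mul_assoc, Matrix.mul_assoc, Matrix.nonsing_inv_mul _ hdet,
      Matrix.mul_one, ← Matrix.mul_assoc, Matrix.mul_nonsing_inv _ hdet, Matrix.one_mul]
  have hmap : (multivariateGaussian 0 (Ω₀⁻¹ * S₀ * Ω₀⁻¹)).map (D ∘ A) =
      (multivariateGaussian 0 S₀).map (D ∘ id) := by
    rw [← Measure.map_map hDc.measurable A.continuous.measurable, hgauss, Function.comp_id]
  rw [hLD]
  refine ⟨hLRmeas, (hDc.comp A.continuous).measurable.aemeasurable, ?_⟩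
  -- Convergence in distribution sees only the law of the limit, so `D` under `N(0, Σ₀)` may be
  -- exchanged for `D ∘ A` under the law of `Z`.
  exact hlimit.tendsto.mono_right (le_of_eq (congrArg 𝓝 (Subtype.ext hmap.symm)))
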